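/- For $n\ge 0$ let $\mathcal P^0(n)$ be the set of partitions $\lambda\vdash 2n$ with empty $2$-core, i.e. whose Young diagram can be reduced to the empty diagram by successively removing dominoes ($1\times2$ or $2\times1$ rectangles), every intermediate shape being a Young diagram. Rows are numbered downwards and $[n]=\{1,\dots,n\}$. A standard domino tableau $T$ of shape $\lambda$ is a tiling of the Young diagram of $\lambda$ by $n$ dominoes labelled bijectively by $[n]$ such that the labels increase along the rows and down the columns; $SDT(\lambda)$ is the set of these. Its descent set $Des(T)\subseteq\{0\}\cup[n-1]$ contains $i\in[n-1]$ if and only if the domino $i+1$ lies strictly below the domino $i$, and contains $0$ if and only if the domino labelled $1$ exists and is vertical. For partitions $\mu,\nu$ with $|\mu|+|\nu|=n$, a standard bi-tableau $(T_1,T_2)\in SBT(\mu,\nu)$ is a bijective filling of the boxes of the pair of Young diagrams of $\mu$ and $\nu$ with the elements of $[n]$, both $T_1$ and $T_2$ being strictly increasing along rows and down columns. Its descent set $Des_r(T_1,T_2)\subseteq\{0\}\cup[n-1]$ contains: each $s\in[n-1]$ such that $s,s+1$ are in the same tableau and $s+1$ is in a lower row than $s$; each $s\in[n-1]$ such that $s\in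 T_2$ and $s+1\in T_1$; and $0$ if $1\in T_1$. The content of a box is its column index minus its row index. To $T\in SDT(\lambda)$ is associated the bi-tableau $(T^-,T^+)$: give a box the sign $-$ if its content is even and $+$ if it is odd (so the top left box has sign $-$ and adjacent boxes have opposite signs). $T^-$ (resp. $T^+$) contains the labels of the dominoes whose top rightmost box (the right box of a horizontal domino, the upper box of a vertical one) has sign $-$ (resp. $+$); a label whose domino has its top rightmost box of content $2k$ (resp. $2k+1$) is placed on the diagonal of content $k$ of $T^-$ (resp. $T^+$). The $2$-quotient $(\lambda^-,\lambda^+)$ of $\lambda$ is the common bi-shape of the bi-tableaux $(T^-,T^+)$, $T\in SDT(\lambda)$. **Lemma.** Let $\lambda\in\mathcal P^0(n)$. The $2$-quotient $(\lambda^-,\lambda^+)$ is well defined: there is exactly one pair of partitions $(\lambda^-,\lambda^+)$ such that for every $T\in SDT(\lambda)$ the bi-tableau $(T^-,T^+)$ exists in $SBT(\lambda^-,\lambda^+)$. Moreover, there is a bijection $\phi_3: SBT(\lambda^-,\lambda^+)\to SDT(\lambda)$ such that for all $(T_1,T_2)\in SBT(\lambda^-,\lambda^+)$ $$Des_r(T_1,T_2)=Des(\phi_3(T_1,T_2)).$$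 -/

import Mathlib

/-- Boxes are pairs `(i, j)` (row `i`, column `j`, both counted from `0`, rows going downwards).
A domino is a `1 × 2` or a `2 × 1` rectangle. -/
def IsHorizontalDomino (s : Finset (ℕ × ℕ)) : Prop :=
  ∃ i j : ℕ, s = {(i, j), (i, j + 1)}

def IsVerticalDomino (s : Finset (ℕ × ℕ)) : Prop :=
  ∃ i j : ℕ, s = {(i, j), (i + 1, j)}

def IsDomino (s : Finset (ℕ × ℕ)) : Prop :=
  IsHorizontalDomino s ∨ IsVerticalDomino s

/-- A partition (Young diagram) has an empty 2-core if it can be reduced to the empty diagram by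
successively removing dominoes, all the intermediate shapes being Young diagrams. -/
inductive HasEmptyTwoCore : YoungDiagram → Prop
  | bot : HasEmptyTwoCore ⊥
  | add_domino (μ ν : YoungDiagram) (hle : μ ≤ ν) (hd : IsDomino (ν.cells \ μ.cells))
      (hμ : HasEmptyTwoCore μ) : HasEmptyTwoCore ν

/-- The set of partitions of `2 * n` with empty 2-core. -/
def EmptyTwoCorePartitions (n : ℕ) : Set YoungDiagram :=
  {μ | μ.card = 2 * n ∧ HasEmptyTwoCore μ}

/-- Standard domino tableaux of shape `μ` with labels `1, …, n`: the boxes carrying a given label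
form one domino, and labels increase along the rows and down the columns (hence strictly when
passing from one domino to another one). By convention `entry` is `0` outside `μ`. -/
@[ext]
structure StandardDominoTableau (n : ℕ) (μ : YoungDiagram) where
  entry : ℕ → ℕ → ℕ
  entry_mem : ∀ i j, (i, j) ∈ μ → entry i j ∈ Set.Icc 1 n
  isDomino : ∀ a ∈ Set.Icc 1 n, IsDomino (μ.cells.filter fun c => entry c.1 c.2 = a)
  row_le : ∀ i j₁ j₂, j₁ < j₂ → (i, j₂) ∈ μ → entry i j₁ ≤ entry i j₂
  col_le : ∀ i₁ i₂ j, i₁ < i₂ → (i₂, j) ∈ μ → entry i₁ j ≤ entry i₂ j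
  zeros : ∀ i j, (i, j) ∉ μ → entry i j = 0

namespace StandardDominoTableau

variable {n : ℕ} {μ : YoungDiagram}

/-- The domino labelled `a`. -/
def domino (T : StandardDominoTableau n μ) (a : ℕ) : Finset (ℕ × ℕ) :=
  μ.cells.filter fun c => T.entry c.1 c.2 = a

/-- The descent set: `i > 0` is a descent if the domino `i + 1` lies strictly below the domino
`i`; `0` is a descent if the domino labelled `1` is vertical. -/
def Des (T : StandardDominoTableau n μ) : Set ℕ :=
  {i | 1 ≤ i ∧ i + 1 ≤ n ∧ ∀ c ∈ T.domino i, ∀ d ∈ T.domino (i + 1), c.1 < d.1} ∪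
    {i | i = 0 ∧ IsVerticalDomino (T.domino 1)}

end StandardDominoTableau

/-- Standard bi-tableaux of bi-shape `(μ, ν)` with labels `1, …, n`: a filling `fst` of `μ` and a
filling `snd` of `ν`, both strictly increasing along rows and down columns, such that each of the
labels `1, …, n` is used in exactly one box of the two diagrams (and no other label is used).
By convention the fillings are `0` outside the diagrams. -/
@[ext]
structure StandardBiTableau (n : ℕ) (μ ν : YoungDiagram) where
  fst : ℕ → ℕ → ℕ
  snd : ℕ → ℕ → ℕ
  bijOn : Set.BijOn (Sum.elim (fun c : ℕ × ℕ => fst c.1 c.2) (fun c : ℕ × ℕ => snd c.1 c.2))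
    (μ.cells.disjSum ν.cells) (Set.Icc 1 n)
  fst_row_lt : ∀ i j₁ j₂, j₁ < j₂ → (i, j₂) ∈ μ → fst i j₁ < fst i j₂
  fst_col_lt : ∀ i₁ i₂ j, i₁ < i₂ → (i₂, j) ∈ μ → fst i₁ j < fst i₂ j
  snd_row_lt : ∀ i j₁ j₂, j₁ < j₂ → (i, j₂) ∈ ν → snd i j₁ < snd i j₂
  snd_col_lt : ∀ i₁ i₂ j, i₁ < i₂ → (i₂, j) ∈ ν → snd i₁ j < snd i₂ j
  fst_zeros : ∀ i j, (i, j) ∉ μ → fst i j = 0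
  snd_zeros : ∀ i j, (i, j) ∉ ν → snd i j = 0

namespace StandardBiTableau

variable {n : ℕ} {μ ν : YoungDiagram}

/-- The label `a` is in the box `(i, j)` of the first tableau. -/
def FstAt (B : StandardBiTableau n μ ν) (a i j : ℕ) : Prop :=
  (i, j) ∈ μ ∧ B.fst i j = a

/-- The label `a` is in the box `(i, j)` of the second tableau. -/
def SndAt (B : StandardBiTableau n μ ν) (a i j : ℕ) : Prop :=
  (i, j) ∈ ν ∧ B.snd i j = a

/-- The descent set `Des_r` of a standard bi-tableau `(T₁, T₂)`: the `s ∈ {1, …, n - 1}` such that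
`s` and `s + 1` appear in the same tableau with `s + 1` in a lower row, those with `s` in `T₂` and
`s + 1` in `T₁`, and `0` if `1` is in `T₁`. -/
def DesR (B : StandardBiTableau n μ ν) : Set ℕ :=
  {s | 1 ≤ s ∧ s + 1 ≤ n ∧
    ((∃ i j i' j', B.FstAt s i j ∧ B.FstAt (s + 1) i' j' ∧ i < i') ∨
      (∃ i j i' j', B.SndAt s i j ∧ B.SndAt (s + 1) i' j' ∧ i < i') ∨
      (∃ i j i' j', B.SndAt s i j ∧ B.FstAt (s + 1) i' j'))} ∪
    {s | s = 0 ∧ ∃ i j, B.FstAt 1 i j}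

/-- `B` is the bi-tableau `(T⁻, T⁺)` associated with the standard domino tableau `T`.
Put signs on the boxes in checkerboard fashion, the top left box `(0, 0)` being `-`; thus a box is
`-` exactly if its content (column minus row) is even. Then `T⁻` (resp. `T⁺`) consists of the
labels of the dominoes whose top rightmost box has sign `-` (resp. `+`), and the dominoes whose top
rightmost box lies on the diagonal of content `2 * k` (resp. `2 * k + 1`) give the boxes on the
diagonal of content `k` of `T⁻` (resp. `T⁺`).
The top rightmost box of a horizontal domino is its right box, that of a vertical domino is its
upper box. -/
def IsAssociated {lam : YoungDiagram} (B : StandardBiTableau n μ ν)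
    (T : StandardDominoTableau n lam) : Prop :=
  ∀ a ∈ Set.Icc 1 n, ∀ r c : ℕ, (r, c) ∈ T.domino a →
    (∀ d ∈ T.domino a, r ≤ d.1 ∧ d.2 ≤ c) → ∀ k : ℤ,
      ((c : ℤ) - r = 2 * k → ∃ i j : ℕ, B.FstAt a i j ∧ (j : ℤ) - i = k) ∧
      ((c : ℤ) - r = 2 * k + 1 → ∃ i j : ℕ, B.SndAt a i j ∧ (j : ℤ) - i = k)

end StandardBiTableau

/-- `(μ, ν)` is the 2-quotient `(λ⁻, λ⁺)` of `lam` (a partition of `2 * n` with empty 2-core): it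
is the bi-shape of the bi-tableau `(T⁻, T⁺)` for every standard domino tableau `T` of shape
`lam`. -/
def IsTwoQuotient (n : ℕ) (lam μ ν : YoungDiagram) : Prop :=
  ∀ T : StandardDominoTableau n lam, ∃ B : StandardBiTableau n μ ν, B.IsAssociated T

/-! Both kinds of tableaux are encoded by one integer sequence. For a domino tableau, `h a` is the
content of the top rightmost box of the domino `a` (its head). For a bi-tableau, `h a = 2 * k` or `2
* k + 1` says that `a` lies on the diagonal of content `k` of the first or of the second tableau.
Being associated means having the same sequence.

A Young diagram is determined by its diagonal sizes, and `IsDiagProfile` says which sizes occur. A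
domino with head `m` has one box of content `m - 1` and one of content `m`. So if `c m` dominoes
have head `m`, the diagonal sizes are `d k = c k + c (k + 1)`, and `d k - d (k - 1) = c (k + 1) - c
(k - 1)` compares only values of `c` of the same parity. Hence `d` is a profile exactly if the even
and the odd part of `c` are (`isDiagProfile_domino_iff`). Applied to all initial segments of labels,
this identifies the two sets of sequences. Moreover `d` determines `c` (`eq_of_add_succ_eq`), so the
bi-shape does not depend on the tableau. This yields the 2-quotient and a bijection preserving
heads.

The descents of a domino tableau are the descents of its head sequence, together with `0` if the
first head is `0` (`mem_Des_iff`). In general this is not `DesR` of the bi-tableau with the same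
heads, so a permutation of the bi-tableaux has to be inserted. Bi-tableaux are the linear extensions
of the two diagrams with a bottom element adjoined, and both statistics are descent sets for
labellings of this poset. The two labellings order every pair of neighbours alike
(`PairBox.Adj.headKey_lt_iff`). As in Stanley's theory of `(P, ω)`-partitions, the number of linear
extensions with descents inside a given set depends only on these signs
(`LinExt.card_descents_subset_le`, used in both directions). Inclusion-exclusion then gives
equidistribution, hence a non-canonical permutation. -/

/-! ### Linear extensions and descent sets of labelled posets -/

/-- Linear extensions of a relation on a type with `N` elements, as bijective labellings. -/
def LinExt {P : Type*} (r : P → P → Prop) (N : ℕ) : Type _ :=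
  {L : P ≃ Fin N // ∀ x y, r x y → L x < L y}

namespace LinExt

variable {P : Type*} {r : P → P → Prop} {n : ℕ} {α β : Type*} [LinearOrder α] [LinearOrder β]

/-- The descent set of a linear extension with respect to the labelling `ω`. -/
def descents (ω : P → α) (L : P ≃ Fin (n + 1)) : Finset (Fin n) :=
  Finset.univ.filter fun s => ω (L.symm s.succ) < ω (L.symm s.castSucc)

theorem mem_descents {ω : P → α} {L : P ≃ Fin (n + 1)} {s : Fin n} :
    s ∈ descents ω L ↔ ω (L.symm s.succ) < ω (L.symm s.castSucc) := by
  simp [descents]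

/-- The index of the block containing `i` when `{0, …, n}` is cut after every element of `D`. -/
def block (D : Finset (Fin n)) (i : Fin (n + 1)) : ℕ :=
  (D.filter fun d => d.castSucc < i).card

theorem block_mono (D : Finset (Fin n)) : Monotone (block D) := fun i j hij =>
  Finset.card_le_card fun d hd => by
    simp only [Finset.mem_filter] at hd ⊢
    exact ⟨hd.1, hd.2.trans_le hij⟩

theorem block_lt {D : Finset (Fin n)} {i j : Fin (n + 1)} {d : Fin n} (hd : d ∈ D)
    (hi : i ≤ d.castSucc) (hj : d.castSucc < j) : block D i < block D j := by
  refine Finset.card_lt_card ((Finset.ssubset_iff_of_subset ?_).2 ⟨d, ?_, ?_⟩)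
  · intro e he
    simp only [Finset.mem_filter] at he ⊢
    exact ⟨he.1, he.2.trans (hi.trans_lt hj)⟩
  · simp [hd, hj]
  · simp [hi]

theorem mem_of_block_lt {D : Finset (Fin n)} {s : Fin n}
    (h : block D s.castSucc < block D s.succ) : s ∈ D := by
  by_contra hs
  refine h.not_ge (Finset.card_le_card fun d hd => ?_)
  simp only [Finset.mem_filter] at hd ⊢
  refine ⟨hd.1, ?_⟩
  have h1 : d ≠ s := fun h => hs (h ▸ hd.1)
  have h2 := hd.2
  simp only [Fin.lt_def, Fin.val_castSucc, Fin.val_succ, ne_eq, Fin.ext_iff] at *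
  omega

/-- If all descents are in `D`, then `ω` is increasing inside each block. -/
theorem lt_of_block_eq {ω : P → α} (hω : Function.Injective ω) {L : P ≃ Fin (n + 1)}
    {D : Finset (Fin n)} (hD : descents ω L ⊆ D) :
    ∀ i j : Fin (n + 1), i < j → block D i = block D j → ω (L.symm i) < ω (L.symm j) := by
  intro i j
  induction j using Fin.induction with
  | zero => intro h; exact absurd h (Fin.not_lt_zero i)
  | succ s ih =>
    intro hij hb
    have his : i ≤ s.castSucc := Fin.le_castSucc_iff.2 hij
    have hs : s ∉ D := fun h => (block_lt h his s.castSucc_lt_succ).ne hb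
    have h1 : ω (L.symm s.castSucc) < ω (L.symm s.succ) := by
      refine lt_of_le_of_ne (not_lt.1 fun h => hs (hD (mem_descents.2 h))) fun h => ?_
      exact s.castSucc_lt_succ.ne (L.symm.injective (hω h))
    rcases his.lt_or_eq with h | h
    · refine (ih h (le_antisymm (block_mono D his) ?_)).trans h1
      rw [hb]
      exact block_mono D s.castSucc_lt_succ.le
    · rwa [h]

/-- The list `L.symm` is `P` sorted by a key depending only on the element: its block, then its
label. The form `L (L.symm i)` keeps this dependence visible, so that two extensions with equal
blocks share their key. -/
theorem key_strictMono {ω : P → α} (hω : Function.Injective ω) {L : P ≃ Fin (n + 1)}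
    {D : Finset (Fin n)} (hD : descents ω L ⊆ D) :
    StrictMono fun i => toLex (block D (L (L.symm i)), ω (L.symm i)) := by
  intro i j hij
  simp only [Equiv.apply_symm_apply, Prod.Lex.toLex_lt_toLex]
  rcases (block_mono D hij.le).lt_or_eq with h | h
  · exact Or.inl h
  · exact Or.inr ⟨h, lt_of_block_eq hω hD i j hij h⟩

/-- A linear extension with descents in `D` is determined by its blocks. -/
theorem eq_of_block_eq {ω : P → α} (hω : Function.Injective ω) {L M : P ≃ Fin (n + 1)}
    {D : Finset (Fin n)} (hL : descents ω L ⊆ D) (hM : descents ω M ⊆ D)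
    (h : ∀ x, block D (L x) = block D (M x)) : L = M := by
  have h1 := key_strictMono hω hL
  have h2 := key_strictMono hω hM
  -- Two strictly increasing enumerations of the same set of keys coincide.
  have key := (StrictMono.range_inj h1 h2).1 <| by
    ext z
    simp only [Set.mem_range]
    constructor
    · rintro ⟨i, rfl⟩
      exact ⟨M (L.symm i), by simp [← h]⟩
    · rintro ⟨i, rfl⟩
      exact ⟨L (M.symm i), by simp [h]⟩
  refine Equiv.symm_bijective.injective (Equiv.ext fun i => hω ?_)
  have := congrFun key i
  simp only [EmbeddingLike.apply_eq_iff_eq, Prod.mk.injEq] at this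
  exact this.2

theorem exists_sort [Fintype P] {N : ℕ} (hN : Fintype.card P = N) {κ : P → α}
    (hκ : Function.Injective κ) : ∃ L : P ≃ Fin N, ∀ x y, L x < L y ↔ κ x < κ y := by
  let _ : LinearOrder P := LinearOrder.lift' κ hκ
  exact ⟨(Fintype.orderIsoFinOfCardEq P hN).symm.toEquiv, fun x y =>
    (Fintype.orderIsoFinOfCardEq P hN).symm.lt_iff_lt⟩

/-- Sorting each block according to another labelling with the same signs on `r`. -/
theorem exists_resort {ω : P → α} {ω' : P → β} (hω : Function.Injective ω)
    (hω' : Function.Injective ω') (hr : ∀ x y, r x y → ω x < ω y → ω' x < ω' y)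
    (D : Finset (Fin n)) (L : LinExt r (n + 1)) (hL : descents ω L.1 ⊆ D) :
    ∃ M : LinExt r (n + 1), descents ω' M.1 ⊆ D ∧ ∀ x, block D (L.1 x) = block D (M.1 x) := by
  obtain ⟨L, hLr⟩ := L
  have : Fintype P := Fintype.ofEquiv _ L.symm
  have hκ : Function.Injective fun x => toLex (block D (L x), ω' x) := by
    intro x y hxy
    simp only [EmbeddingLike.apply_eq_iff_eq, Prod.mk.injEq] at hxy
    exact hω' hxy.2
  obtain ⟨M, hM⟩ := exists_sort (by simpa using Fintype.card_congr L) hκ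
  simp only [Prod.Lex.toLex_lt_toLex] at hM
  -- Sorting permutes the block indices into a monotone sequence. They were already monotone along
  -- `L`, so nothing changes: every element keeps its block.
  have hMmono : Monotone (block D ∘ (M.symm.trans L)) := by
    intro i j hij
    rcases hij.lt_or_eq with h | h
    · have := (hM (M.symm i) (M.symm j)).1 (by simpa using h)
      rcases this with h | h
      · exact h.le
      · exact h.1.le
    · rw [h]
  have hb : block D ∘ (M.symm.trans L) = block D :=
    Tuple.unique_monotone (σ := M.symm.trans L) (τ := Equiv.refl _) hMmono (block_mono D)
  have hb' : ∀ x, block D (L x) = block D (M x) := fun x => by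
    simpa using congrFun hb (M x)
  refine ⟨⟨M, fun x y hxy => ?_⟩, fun s hs => ?_, hb'⟩
  · rw [hM]
    have h := hLr x y hxy
    rcases (block_mono D h.le).lt_or_eq with h' | h'
    · exact Or.inl h'
    · exact Or.inr ⟨h', hr x y hxy (by simpa using lt_of_block_eq hω hL _ _ h h')⟩
  · rw [mem_descents] at hs
    apply mem_of_block_lt
    have h := (hM (M.symm s.castSucc) (M.symm s.succ)).1 (by simp)
    rcases h with h | h
    · simpa [hb'] using h
    · exact absurd h.2 hs.not_gt

instance [Finite P] {N : ℕ} : Finite (LinExt r N) := Subtype.finite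

/-- Resorting inside the blocks is injective, because the blocks survive it and determine the
original extension. -/
theorem card_descents_subset_le [Finite P] {ω : P → α} {ω' : P → β} (hω : Function.Injective ω)
    (hω' : Function.Injective ω') (hr : ∀ x y, r x y → ω x < ω y → ω' x < ω' y)
    (D : Finset (Fin n)) :
    Nat.card {L : LinExt r (n + 1) // descents ω L.1 ⊆ D} ≤
      Nat.card {L : LinExt r (n + 1) // descents ω' L.1 ⊆ D} := by
  choose f hf using fun L : {L : LinExt r (n + 1) // descents ω L.1 ⊆ D} =>
    exists_resort hω hω' hr D L.1 L.2
  refine Nat.card_le_card_of_injective (fun L => ⟨f L, (hf L).1⟩) fun L M hLM => ?_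
  simp only [Subtype.mk.injEq] at hLM
  refine Subtype.ext (Subtype.ext (eq_of_block_eq hω L.2 M.2 fun x => ?_))
  rw [(hf L).2, (hf M).2, hLM]

end LinExt

/-! ### From counts of contained sets to equal distributions -/

theorem card_subset_eq_sum {A γ : Type*} [Finite A] (f : A → Finset γ) (D : Finset γ) :
    Nat.card {a // f a ⊆ D} = ∑ S ∈ D.powerset, Nat.card {a // f a = S} := by
  classical
  have := Fintype.ofFinite A
  simp only [Nat.card_eq_fintype_card, Fintype.card_subtype]
  rw [Finset.card_eq_sum_card_fiberwise (f := f) (t := D.powerset) (fun x hx => by simpa using hx)]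
  refine Finset.sum_congr rfl fun S hS => ?_
  congr 1
  ext x
  simp only [Finset.mem_powerset, Finset.mem_filter, Finset.mem_univ, true_and] at *
  exact ⟨fun hx => hx.2, fun hx => ⟨hx ▸ hS, hx⟩⟩

/-- If, for all `D`, two finite-set-valued statistics take equally often a value contained in `D`,
then they have the same distribution. -/
theorem card_fiber_eq_of_card_subset_eq {A B γ : Type*} [Finite A] [Finite B] (f : A → Finset γ)
    (g : B → Finset γ) (h : ∀ D, Nat.card {a // f a ⊆ D} = Nat.card {b // g b ⊆ D})
    (D : Finset γ) : Nat.card {a // f a = D} = Nat.card {b // g b = D} := by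
  classical
  -- The count for subsets of `D` is the count for `D` itself plus those for its proper subsets,
  -- which agree by induction and cancel.
  induction D using Finset.strongInduction with
  | H D ih =>
    have hD := h D
    rw [card_subset_eq_sum, card_subset_eq_sum,
      ← Finset.sum_erase_add _ _ (Finset.mem_powerset_self D),
      ← Finset.sum_erase_add _ _ (Finset.mem_powerset_self D)] at hD
    rw [Finset.sum_congr rfl fun S hS => ih S ?_] at hD
    · exact Nat.add_left_cancel hD
    · rw [Finset.mem_erase, Finset.mem_powerset] at hS
      exact hS.2.ssubset_of_ne hS.1

/-- Labellings with the same signs on `r` have equidistributed descent sets. -/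
theorem LinExt.exists_perm_descents_eq {P : Type*} [Finite P] {r : P → P → Prop} {n : ℕ}
    {α β : Type*} [LinearOrder α] [LinearOrder β] {ω : P → α} {ω' : P → β}
    (hω : Function.Injective ω) (hω' : Function.Injective ω')
    (hr : ∀ x y, r x y → (ω x < ω y ↔ ω' x < ω' y)) :
    ∃ σ : LinExt r (n + 1) ≃ LinExt r (n + 1),
      ∀ L, descents ω' (σ L).1 = descents ω L.1 := by
  have key := card_fiber_eq_of_card_subset_eq
    (fun L : LinExt r (n + 1) => descents ω L.1) (fun L : LinExt r (n + 1) => descents ω' L.1)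
    fun D => le_antisymm
      (card_descents_subset_le hω hω' (fun x y hxy => (hr x y hxy).1) D)
      (card_descents_subset_le hω' hω (fun x y hxy => (hr x y hxy).2) D)
  have e := fun D => (Finite.card_eq.1 (key D)).some
  exact ⟨Equiv.ofFiberEquiv e, fun L => Equiv.ofFiberEquiv_map e L⟩

/-! ### Young diagrams as profiles of diagonal sizes -/

/-- The number of boxes of `s` of content `k`. -/
def diagCard (s : Finset (ℕ × ℕ)) (k : ℤ) : ℕ :=
  (s.filter fun c => (c.2 : ℤ) - c.1 = k).card

/-- The condition on the sizes of the diagonals that characterizes Young diagrams. -/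
def IsDiagProfile (d : ℤ → ℕ) : Prop :=
  ∀ k, (k ≤ 0 → d (k - 1) ≤ d k ∧ d k ≤ d (k - 1) + 1) ∧
    (1 ≤ k → d k ≤ d (k - 1) ∧ d (k - 1) ≤ d k + 1)

theorem mem_iff_lt_card_of_isLowerSet {s : Finset ℕ} (hs : IsLowerSet (s : Set ℕ)) (t : ℕ) :
    t ∈ s ↔ t < s.card := by
  constructor
  · intro ht
    have : Finset.range (t + 1) ⊆ s := fun u hu =>
      hs (by simpa [Nat.lt_succ_iff] using hu) ht
    simpa using Finset.card_le_card this
  · intro ht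
    by_contra h
    have : s ⊆ Finset.range t := fun u hu => by
      rw [Finset.mem_range]
      by_contra hut
      exact h (hs (not_lt.1 hut) hu)
    exact ht.not_ge (by simpa using Finset.card_le_card this)

/-- On a fixed diagonal `min i j` is the position of a box, and a lower set meets the diagonal in an
initial segment of positions. -/
theorem mem_iff_min_lt_diagCard {s : Finset (ℕ × ℕ)} (hs : IsLowerSet (s : Set (ℕ × ℕ)))
    (i j : ℕ) : (i, j) ∈ s ↔ min i j < diagCard s ((j : ℤ) - i) := by
  set u : Finset ℕ := (s.filter fun c => (c.2 : ℤ) - c.1 = (j : ℤ) - i).image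
    (fun c => min c.1 c.2) with hu
  have hcard : u.card = diagCard s ((j : ℤ) - i) := by
    refine Finset.card_image_of_injOn fun c hc d hd hcd => ?_
    simp only [Finset.coe_filter, Set.mem_ofPred_eq] at hc hd hcd
    ext <;> omega
  have hmem : ∀ t, t ∈ u ↔ (t + i - min i j, t + j - min i j) ∈ s := by
    intro t
    simp only [hu, Finset.mem_image, Finset.mem_filter, Prod.exists]
    constructor
    · rintro ⟨a, b, ⟨h1, h2⟩, h3⟩
      convert h1 using 2 <;> omega
    · intro h
      exact ⟨_, _, ⟨h, by omega⟩, by omega⟩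
  have hlow : IsLowerSet (u : Set ℕ) := by
    intro a b hab ha
    rw [Finset.mem_coe, hmem] at ha ⊢
    exact hs (Prod.mk_le_mk.2 ⟨by omega, by omega⟩) ha
  rw [← hcard, ← mem_iff_lt_card_of_isLowerSet hlow, hmem]
  congr! 2 <;> omega

/-- Each of the four inequalities comes from moving one box up or left, onto the neighbouring
diagonal. -/
theorem isDiagProfile_diagCard {s : Finset (ℕ × ℕ)} (hs : IsLowerSet (s : Set (ℕ × ℕ))) :
    IsDiagProfile (diagCard s) := by
  have key : ∀ i j : ℕ, ∀ k : ℤ, (j : ℤ) - i = k → ((i, j) ∈ s ↔ min i j < diagCard s k) := by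
    rintro i j k rfl
    exact mem_iff_min_lt_diagCard hs i j
  have low : ∀ i j i' j' : ℕ, i' ≤ i → j' ≤ j → (i, j) ∈ s → (i', j') ∈ s :=
    fun i j i' j' h1 h2 h => hs (Prod.mk_le_mk.2 ⟨h1, h2⟩) h
  intro k
  constructor
  · intro hk
    obtain ⟨m, rfl⟩ : ∃ m : ℕ, k = -m := ⟨k.natAbs, by omega⟩
    refine ⟨not_lt.1 fun h => ?_, not_lt.1 fun h => ?_⟩
    · have h1 := (key (diagCard s (-m) + m + 1) (diagCard s (-m)) (-m - 1) (by omega)).2 (by omega)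
      have h2 := (key (diagCard s (-m) + m) (diagCard s (-m)) (-m) (by omega)).1
        (low _ _ _ _ (by omega) le_rfl h1)
      omega
    · set t := diagCard s (-m - 1)
      have h1 := (key (t + 1 + m) (t + 1) (-m) (by omega)).2 (by omega)
      have h2 := (key (t + 1 + m) t (-m - 1) (by omega)).1
        (low _ _ _ _ (by omega) (by omega) h1)
      omega
  · intro hk
    obtain ⟨m, rfl⟩ : ∃ m : ℕ, k = m + 1 := ⟨(k - 1).toNat, by omega⟩
    rw [add_sub_cancel_right]
    refine ⟨not_lt.1 fun h => ?_, not_lt.1 fun h => ?_⟩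
    · set t := diagCard s m
      have h1 := (key t (t + (m + 1)) (m + 1) (by omega)).2 (by omega)
      have h2 := (key t (t + m) m (by omega)).1 (low _ _ _ _ (by omega) (by omega) h1)
      omega
    · set t := diagCard s (m + 1)
      have h1 := (key (t + 1) (t + 1 + m) m (by omega)).2 (by omega)
      have h2 := (key t (t + (m + 1)) (m + 1) (by omega)).1
        (low _ _ _ _ (by omega) (by omega) h1)
      omega

/-- The boxes lying on the first `d k` places of the diagonals form a lower set. -/
theorem IsDiagProfile.min_lt {d : ℤ → ℕ} (hd : IsDiagProfile d) {i j i' j' : ℕ} (hi : i' ≤ i)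
    (hj : j' ≤ j) (h : min i j < d ((j : ℤ) - i)) : min i' j' < d ((j' : ℤ) - i') := by
  have row : ∀ i j : ℕ, min (i + 1) j < d ((j : ℤ) - (i + 1 : ℕ)) → min i j < d ((j : ℤ) - i) := by
    intro i j h
    have h1 := hd ((j : ℤ) - i)
    rw [show (j : ℤ) - (i + 1 : ℕ) = (j : ℤ) - i - 1 by push_cast; ring] at h
    omega
  have col : ∀ i j : ℕ, min i (j + 1) < d (((j + 1 : ℕ) : ℤ) - i) → min i j < d ((j : ℤ) - i) := by
    intro i j h
    have h1 := hd ((j : ℤ) - i + 1)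
    rw [show ((j + 1 : ℕ) : ℤ) - i = (j : ℤ) - i + 1 by push_cast; ring] at h
    rw [add_sub_cancel_right] at h1
    omega
  have h1 : min i' j < d ((j : ℤ) - i') :=
    Nat.decreasingInduction (motive := fun a _ => min a j < d ((j : ℤ) - a))
      (fun a _ => row a j) h hi
  exact Nat.decreasingInduction (motive := fun a _ => min i' a < d ((a : ℤ) - i'))
      (fun a _ => col i' a) h1 hj

theorem YoungDiagram.eq_of_diagCard_eq {μ ν : YoungDiagram}
    (h : ∀ k, diagCard μ.cells k = diagCard ν.cells k) : μ = ν := by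
  ext ⟨i, j⟩
  rw [mem_iff_min_lt_diagCard μ.isLowerSet, mem_iff_min_lt_diagCard ν.isLowerSet, h]

theorem IsDiagProfile.exists_youngDiagram {d : ℤ → ℕ} (hd : IsDiagProfile d)
    (hfin : {k | d k ≠ 0}.Finite) : ∃ μ : YoungDiagram, ∀ k, diagCard μ.cells k = d k := by
  have hS : {c : ℕ × ℕ | min c.1 c.2 < d ((c.2 : ℤ) - c.1)}.Finite := by
    -- The box at position `t` of the diagonal `k` is `(t + max (-k) 0, t + max k 0)`; truncation by
    -- `toNat` treats both signs of `k` at once.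
    refine Set.Finite.subset (hfin.toFinset.biUnion fun k =>
      (Finset.range (d k)).image fun t : ℕ => (t + (-k).toNat, t + k.toNat)).finite_toSet ?_
    rintro ⟨i, j⟩ h
    simp only [Set.mem_ofPred_eq] at h
    simp only [Finset.coe_biUnion, Set.mem_iUnion, Finset.mem_coe, Set.Finite.mem_toFinset,
      Set.mem_ofPred_eq, Finset.mem_image, Finset.mem_range, Prod.mk.injEq]
    exact ⟨(j : ℤ) - i, by omega, min i j, h, by omega, by omega⟩
  have hmem : ∀ i j : ℕ, (i, j) ∈ hS.toFinset ↔ min i j < d ((j : ℤ) - i) := by simp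
  have hlow : IsLowerSet (hS.toFinset : Set (ℕ × ℕ)) := by
    rintro ⟨i, j⟩ ⟨i', j'⟩ hle h
    rw [Finset.mem_coe, hmem] at h ⊢
    exact hd.min_lt hle.1 hle.2 h
  refine ⟨⟨hS.toFinset, hlow⟩, fun k => ?_⟩
  have key : ∀ t, t < diagCard hS.toFinset k ↔ t < d k := by
    intro t
    have h1 := mem_iff_min_lt_diagCard hlow (t + (-k).toNat) (t + k.toNat)
    rw [hmem] at h1
    have h2 : ((t + k.toNat : ℕ) : ℤ) - (t + (-k).toNat : ℕ) = k := by omega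
    have h3 : min (t + (-k).toNat) (t + k.toNat) = t := by omega
    rw [h2, h3] at h1
    exact h1.symm
  exact le_antisymm (not_lt.1 fun h => (lt_irrefl _ ((key _).1 h)))
    (not_lt.1 fun h => (lt_irrefl _ ((key _).2 h)))

/-! ### Splitting domino profiles by parity -/

/-- The profile obtained by adding, for each `m`, `c m` dominoes with boxes of contents `m - 1` and
`m` splits into the profiles formed by the even and by the odd diagonals. -/
theorem isDiagProfile_domino_iff (c : ℤ → ℕ) :
    IsDiagProfile (fun k => c k + c (k + 1)) ↔
      IsDiagProfile (fun k => c (2 * k)) ∧ IsDiagProfile (fun k => c (2 * k + 1)) := by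
  -- The middle terms cancel in the difference of consecutive values. The condition at `2 * k - 1`
  -- is the even one at `k`, the condition at `2 * k` is the odd one at `k`, and the cases `≤ 0` and
  -- `≥ 1` correspond.
  simp only [IsDiagProfile]
  constructor
  · intro h
    constructor
    · intro k
      have := h (2 * k - 1)
      rw [show 2 * k - 1 - 1 = 2 * (k - 1) by ring, show 2 * (k - 1) + 1 = 2 * k - 1 by ring,
        sub_add_cancel] at this
      omega
    · intro k
      have := h (2 * k)
      rw [show 2 * (k - 1) + 1 = 2 * k - 1 by ring]
      rw [sub_add_cancel] at this
      omega
  · rintro ⟨h1, h2⟩ k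
    obtain ⟨k, rfl | rfl⟩ : ∃ l : ℤ, k = 2 * l ∨ k = 2 * l - 1 := ⟨(k + 1) / 2, by omega⟩
    · have := h2 k
      rw [show 2 * (k - 1) + 1 = 2 * k - 1 by ring] at this
      rw [sub_add_cancel]
      omega
    · have := h1 k
      rw [show 2 * k - 1 - 1 = 2 * (k - 1) by ring, show 2 * (k - 1) + 1 = 2 * k - 1 by ring,
        sub_add_cancel]
      omega

/-- The difference `c - c'` changes sign at every step, so its absolute value is constant, and it
vanishes far out. This makes the number of heads of each content an invariant of the shape. -/
theorem eq_of_add_succ_eq {c c' : ℤ → ℕ} (hc : {k | c k ≠ 0}.Finite) (hc' : {k | c' k ≠ 0}.Finite)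
    (h : ∀ k, c k + c (k + 1) = c' k + c' (k + 1)) : c = c' := by
  have step : ∀ k, ((c (k + 1) : ℤ) - c' (k + 1)).natAbs = ((c k : ℤ) - c' k).natAbs := by
    intro k
    have := h k
    omega
  have const : ∀ k : ℤ, ∀ t : ℕ,
      ((c (k + t) : ℤ) - c' (k + t)).natAbs = ((c k : ℤ) - c' k).natAbs := by
    intro k t
    induction t with
    | zero => simp
    | succ t ih => rw [← ih, ← step (k + t)]; push_cast; rw [add_assoc]
  obtain ⟨B, hB⟩ := (hc.union hc').bddAbove
  funext k
  have h1 := const k (B + 1 - k).toNat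
  have h2 : B < k + (B + 1 - k).toNat := by omega
  have h3 : k + ((B + 1 - k).toNat : ℤ) ∉ {k | c k ≠ 0} ∪ {k | c' k ≠ 0} := fun h =>
    h2.not_ge (hB h)
  simp only [Set.mem_union, Set.mem_ofPred_eq, not_or, not_not] at h3
  rw [h3.1, h3.2] at h1
  omega

/-! ### Counting heads, and fillings from chains of profiles -/

/-- The number of the labels `1, …, a` to which `h` assigns the content `m`. -/
def headCount (h : ℕ → ℤ) (a : ℕ) (m : ℤ) : ℕ :=
  ((Finset.Icc 1 a).filter fun s => h s = m).card

theorem headCount_succ (h : ℕ → ℤ) (a : ℕ) (m : ℤ) :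
    headCount h (a + 1) m = headCount h a m + if h (a + 1) = m then 1 else 0 := by
  simp only [headCount]
  rw [← Finset.insert_Icc_right_eq_Icc_add_one (by omega), Finset.filter_insert]
  split_ifs
  · rw [Finset.card_insert_of_notMem (by simp)]
  · rfl

theorem headCount_zero (h : ℕ → ℤ) (m : ℤ) : headCount h 0 m = 0 := by
  simp [headCount]

theorem headCount_mono (h : ℕ → ℤ) (m : ℤ) : Monotone fun a => headCount h a m :=
  monotone_nat_of_le_succ fun a => by
    rw [headCount_succ]
    omega

theorem finite_headCount_ne_zero (h : ℕ → ℤ) (a : ℕ) : {m | headCount h a m ≠ 0}.Finite := by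
  refine ((Finset.Icc 1 a).image h).finite_toSet.subset fun m hm => ?_
  obtain ⟨s, hs⟩ := Finset.card_ne_zero.1 hm
  rw [Finset.mem_filter] at hs
  exact Finset.mem_coe.2 (Finset.mem_image.2 ⟨s, hs⟩)

theorem headCount_add_headCount_succ (h : ℕ → ℤ) (a : ℕ) (k : ℤ) :
    headCount h a k + headCount h a (k + 1) =
      ((Finset.Icc 1 a).filter fun s => h s = k ∨ h s = k + 1).card := by
  rw [Finset.filter_or, Finset.card_union_of_disjoint]
  · rfl
  · exact Finset.disjoint_filter.2 fun s _ h1 h2 => by omega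

/-- The filling of `μ` with entry `a` in the boxes added when passing from `D (a - 1)` to `D a`. -/
noncomputable def chainFilling (D : ℕ → ℤ → ℕ) (μ : YoungDiagram) (i j : ℕ) : ℕ :=
  open Classical in if (i, j) ∈ μ then sInf {a | min i j < D a ((j : ℤ) - i)} else 0

section chainFilling

variable {D : ℕ → ℤ → ℕ} {μ : YoungDiagram} {n : ℕ}

theorem chainFilling_of_notMem {i j : ℕ} (h : (i, j) ∉ μ) : chainFilling D μ i j = 0 :=
  if_neg h

theorem chainFilling_le_iff (hD : ∀ k, Monotone fun a => D a k)
    (hn : ∀ k, D n k = diagCard μ.cells k) {i j : ℕ} (h : (i, j) ∈ μ) (a : ℕ) :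
    chainFilling D μ i j ≤ a ↔ min i j < D a ((j : ℤ) - i) := by
  have hne : {a | min i j < D a ((j : ℤ) - i)}.Nonempty :=
    ⟨n, by rw [Set.mem_ofPred_eq, hn]; exact (mem_iff_min_lt_diagCard μ.isLowerSet i j).1 h⟩
  rw [chainFilling, if_pos h]
  exact ⟨fun h' => (Nat.sInf_mem hne).trans_le (hD _ h'), fun h' => Nat.sInf_le h'⟩

theorem chainFilling_mem_Icc (hD : ∀ k, Monotone fun a => D a k) (h0 : ∀ k, D 0 k = 0)
    (hn : ∀ k, D n k = diagCard μ.cells k) {i j : ℕ} (h : (i, j) ∈ μ) :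
    chainFilling D μ i j ∈ Set.Icc 1 n := by
  constructor
  · by_contra h1
    have := (chainFilling_le_iff hD hn h 0).1 (by omega)
    simp [h0] at this
  · rw [chainFilling_le_iff hD hn h, hn]
    exact (mem_iff_min_lt_diagCard μ.isLowerSet i j).1 h

theorem chainFilling_le_chainFilling (hD : ∀ k, Monotone fun a => D a k) (h0 : ∀ k, D 0 k = 0)
    (hn : ∀ k, D n k = diagCard μ.cells k) (hp : ∀ a ≤ n, IsDiagProfile (D a)) {i j i' j' : ℕ}
    (hi : i' ≤ i) (hj : j' ≤ j) (h : (i, j) ∈ μ) :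
    chainFilling D μ i' j' ≤ chainFilling D μ i j := by
  rw [chainFilling_le_iff hD hn (μ.up_left_mem hi hj h)]
  refine (hp _ (chainFilling_mem_Icc hD h0 hn h).2).min_lt hi hj ?_
  rw [← chainFilling_le_iff hD hn h]

theorem chainFilling_eq_succ_iff (hD : ∀ k, Monotone fun a => D a k)
    (hn : ∀ k, D n k = diagCard μ.cells k) {i j b : ℕ} (hb : b + 1 ≤ n) :
    (i, j) ∈ μ ∧ chainFilling D μ i j = b + 1 ↔
      D b ((j : ℤ) - i) ≤ min i j ∧ min i j < D (b + 1) ((j : ℤ) - i) := by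
  constructor
  · rintro ⟨h, hf⟩
    rw [← chainFilling_le_iff hD hn h, ← not_lt, ← chainFilling_le_iff hD hn h]
    omega
  · rintro ⟨h1, h2⟩
    have h : (i, j) ∈ μ := by
      rw [← YoungDiagram.mem_cells, mem_iff_min_lt_diagCard μ.isLowerSet, ← hn]
      exact h2.trans_le (hD _ hb)
    rw [← chainFilling_le_iff hD hn h] at h2
    rw [← not_lt, ← chainFilling_le_iff hD hn h] at h1
    exact ⟨h, by omega⟩

end chainFilling

theorem isLowerSet_filter_le {μ : YoungDiagram} {e : ℕ → ℕ → ℕ}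
    (hrow : ∀ i j₁ j₂, j₁ < j₂ → (i, j₂) ∈ μ → e i j₁ ≤ e i j₂)
    (hcol : ∀ i₁ i₂ j, i₁ < i₂ → (i₂, j) ∈ μ → e i₁ j ≤ e i₂ j) (a : ℕ) :
    IsLowerSet ((μ.cells.filter fun c => e c.1 c.2 ≤ a : Finset (ℕ × ℕ)) : Set (ℕ × ℕ)) := by
  rintro ⟨i, j⟩ ⟨i', j'⟩ ⟨hi, hj⟩ h
  simp only [Finset.coe_filter, YoungDiagram.mem_cells, Set.mem_ofPred_eq] at *
  refine ⟨μ.up_left_mem hi hj h.1, le_trans ?_ h.2⟩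
  have h1 : e i' j' ≤ e i' j := by
    rcases hj.lt_or_eq with h' | h'
    · exact hrow _ _ _ h' (μ.up_left_mem hi le_rfl h.1)
    · rw [h']
  have h2 : e i' j ≤ e i j := by
    rcases hi.lt_or_eq with h' | h'
    · exact hcol _ _ _ h' h.1
    · rw [h']
  exact h1.trans h2

/-! ### Domino tableaux as head sequences -/

/-- `m` is the content of the top rightmost box of the domino `s`. -/
def IsHead (s : Finset (ℕ × ℕ)) (m : ℤ) : Prop :=
  (∃ r c : ℕ, s = {(r, c), (r, c + 1)} ∧ m = c + 1 - r) ∨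
    ∃ r c : ℕ, s = {(r, c), (r + 1, c)} ∧ m = c - r

theorem IsDomino.exists_isHead {s : Finset (ℕ × ℕ)} (h : IsDomino s) : ∃ m, IsHead s m := by
  rcases h with ⟨r, c, h⟩ | ⟨r, c, h⟩
  · exact ⟨_, Or.inl ⟨r, c, h, rfl⟩⟩
  · exact ⟨_, Or.inr ⟨r, c, h, rfl⟩⟩

theorem IsHead.isDomino {s : Finset (ℕ × ℕ)} {m : ℤ} (h : IsHead s m) : IsDomino s := by
  rcases h with ⟨r, c, h, -⟩ | ⟨r, c, h, -⟩
  · exact Or.inl ⟨r, c, h⟩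
  · exact Or.inr ⟨r, c, h⟩

theorem IsHead.eq_pair {s : Finset (ℕ × ℕ)} {m : ℤ} (h : IsHead s m) :
    ∃ x y : ℕ × ℕ, s = {x, y} ∧ (x.2 : ℤ) - x.1 = m - 1 ∧ (y.2 : ℤ) - y.1 = m := by
  rcases h with ⟨r, c, h, rfl⟩ | ⟨r, c, h, rfl⟩
  · exact ⟨(r, c), (r, c + 1), h, by push_cast; ring, by push_cast; ring⟩
  · exact ⟨(r + 1, c), (r, c), by rw [h, Finset.pair_comm], by push_cast; ring, by push_cast; ring⟩

theorem IsHead.unique {s : Finset (ℕ × ℕ)} {m m' : ℤ} (h : IsHead s m) (h' : IsHead s m') :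
    m = m' := by
  obtain ⟨x, y, rfl, hx, hy⟩ := h.eq_pair
  obtain ⟨x', y', hs, hx', hy'⟩ := h'.eq_pair
  have h1 : x ∈ ({x', y'} : Finset (ℕ × ℕ)) := hs ▸ by simp
  have h2 : y ∈ ({x', y'} : Finset (ℕ × ℕ)) := hs ▸ by simp
  simp only [Finset.mem_insert, Finset.mem_singleton] at h1 h2
  rcases h1 with rfl | rfl <;> rcases h2 with rfl | rfl <;> omega

/-- Head sequences of the standard domino tableaux of shape `μ`. -/
structure IsDominoHeadSeq (n : ℕ) (μ : YoungDiagram) (h : ℕ → ℤ) : Prop where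
  zero : ∀ a ∉ Set.Icc 1 n, h a = 0
  profile : ∀ a ≤ n, IsDiagProfile fun k => headCount h a k + headCount h a (k + 1)
  total : ∀ k, headCount h n k + headCount h n (k + 1) = diagCard μ.cells k

namespace StandardDominoTableau

variable {n : ℕ} {μ : YoungDiagram}

theorem mem_domino {T : StandardDominoTableau n μ} {a : ℕ} {c : ℕ × ℕ} :
    c ∈ T.domino a ↔ c ∈ μ ∧ T.entry c.1 c.2 = a := by
  simp [domino]

/-- The contents of the top rightmost boxes of the dominoes of `T`. -/
noncomputable def heads (T : StandardDominoTableau n μ) (a : ℕ) : ℤ :=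
  open Classical in if h : a ∈ Set.Icc 1 n then (T.isDomino a h).exists_isHead.choose else 0

theorem isHead_heads (T : StandardDominoTableau n μ) {a : ℕ} (ha : a ∈ Set.Icc 1 n) :
    IsHead (T.domino a) (T.heads a) := by
  rw [heads, dif_pos ha]
  exact (T.isDomino a ha).exists_isHead.choose_spec

/-- A domino has exactly one box of content equal to its head and one of content one less. So the
boxes of content `k` correspond to the labels with head `k` or `k + 1`. -/
theorem diagCard_filter_le (T : StandardDominoTableau n μ) {a : ℕ} (ha : a ≤ n) (k : ℤ) :
    diagCard (μ.cells.filter fun c => T.entry c.1 c.2 ≤ a) k =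
      headCount T.heads a k + headCount T.heads a (k + 1) := by
  rw [headCount_add_headCount_succ, diagCard]
  refine Finset.card_bij (fun c _ => T.entry c.1 c.2) ?_ ?_ ?_
  · rintro ⟨i, j⟩ hc
    simp only [Finset.mem_filter, YoungDiagram.mem_cells, Finset.mem_Icc] at hc ⊢
    have hm := T.entry_mem i j hc.1.1
    obtain ⟨x, y, hs, hx, hy⟩ := (T.isHead_heads hm).eq_pair
    have hc' : (i, j) ∈ T.domino (T.entry i j) := mem_domino.2 ⟨hc.1.1, rfl⟩
    rw [hs] at hc'
    simp only [Finset.mem_insert, Finset.mem_singleton] at hc'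
    refine ⟨⟨hm.1, hc.1.2⟩, ?_⟩
    rcases hc' with rfl | rfl
    · right; simp only at hx; omega
    · left; simp only at hy; omega
  · rintro ⟨i, j⟩ hc ⟨i', j'⟩ hd hcd
    simp only [Finset.mem_filter, YoungDiagram.mem_cells] at hc hd hcd
    have hm := T.entry_mem i j hc.1.1
    obtain ⟨x, y, hs, hx, hy⟩ := (T.isHead_heads hm).eq_pair
    have hc' : (i, j) ∈ T.domino (T.entry i j) := mem_domino.2 ⟨hc.1.1, rfl⟩
    have hd' : (i', j') ∈ T.domino (T.entry i j) := mem_domino.2 ⟨hd.1.1, hcd.symm⟩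
    rw [hs] at hc' hd'
    simp only [Finset.mem_insert, Finset.mem_singleton] at hc' hd'
    rcases hc' with rfl | rfl <;> rcases hd' with h | h <;> first | exact h.symm | skip
    · rw [← h] at hy; simp only at hx hy; omega
    · rw [← h] at hx; simp only at hx hy; omega
  · intro b hb
    simp only [Finset.mem_filter, Finset.mem_Icc] at hb
    obtain ⟨x, y, hs, hx, hy⟩ := (T.isHead_heads (a := b) ⟨hb.1.1, hb.1.2.trans ha⟩).eq_pair
    obtain ⟨z, hz, hzk⟩ : ∃ z ∈ T.domino b, (z.2 : ℤ) - z.1 = k := by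
      rw [hs]
      rcases hb.2 with h | h
      · exact ⟨y, by simp, by omega⟩
      · exact ⟨x, by simp, by omega⟩
    obtain ⟨hz1, hz2⟩ := mem_domino.1 hz
    exact ⟨z, by simp [hz1, hz2, hzk, hb.1.2], hz2⟩

theorem isDominoHeadSeq_heads (T : StandardDominoTableau n μ) : IsDominoHeadSeq n μ T.heads where
  zero a ha := dif_neg ha
  profile a ha := by
    have := isDiagProfile_diagCard (isLowerSet_filter_le T.row_le T.col_le a)
    rwa [funext (T.diagCard_filter_le ha)] at this
  total k := by
    rw [← T.diagCard_filter_le le_rfl]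
    congr 1
    exact Finset.filter_true_of_mem fun c hc => (T.entry_mem c.1 c.2 hc).2

/-- The heads give the diagonal sizes of all sublevel sets of the entries. These sets are lower
sets, hence known, and they determine the filling. -/
theorem heads_injective : Function.Injective (heads : StandardDominoTableau n μ → ℕ → ℤ) := by
  intro T T' h
  have key : ∀ a ≤ n, ∀ i j, (i, j) ∈ μ → (T.entry i j ≤ a ↔ T'.entry i j ≤ a) := by
    intro a ha i j hij
    have h1 := mem_iff_min_lt_diagCard (isLowerSet_filter_le T.row_le T.col_le a) i j
    have h2 := mem_iff_min_lt_diagCard (isLowerSet_filter_le T'.row_le T'.col_le a) i j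
    rw [T.diagCard_filter_le ha, h, ← T'.diagCard_filter_le ha, ← h2] at h1
    simpa [hij] using h1
  ext i j
  by_cases hij : (i, j) ∈ μ
  · exact le_antisymm ((key _ (T'.entry_mem i j hij).2 i j hij).2 le_rfl)
      ((key _ (T.entry_mem i j hij).2 i j hij).1 le_rfl)
  · rw [T.zeros i j hij, T'.zeros i j hij]

end StandardDominoTableau

/-- Adding one box on each of the diagonals `m - 1` and `m` to a diagram adds a domino. -/
theorem isHead_of_profile {d d' : ℤ → ℕ} {m : ℤ} (hd : IsDiagProfile d)
    (hdd' : ∀ k, d' k = d k + if m = k ∨ m = k + 1 then 1 else 0) {s : Finset (ℕ × ℕ)}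
    (hs : ∀ i j : ℕ, (i, j) ∈ s ↔ d ((j : ℤ) - i) ≤ min i j ∧ min i j < d' ((j : ℤ) - i)) :
    IsHead s m := by
  have hs' : ∀ i j : ℕ, (i, j) ∈ s ↔ ((j : ℤ) - i = m ∧ min i j = d m) ∨
      ((j : ℤ) - i = m - 1 ∧ min i j = d (m - 1)) := by
    intro i j
    rw [hs, hdd']
    constructor
    · intro h
      have h1 : (j : ℤ) - i = m ∨ (j : ℤ) - i = m - 1 := by
        by_contra h2
        rw [if_neg (by omega)] at h
        omega
      rcases h1 with h1 | h1
      · left; rw [h1] at h; split_ifs at h <;> omega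
      · right; rw [h1] at h; split_ifs at h <;> omega
    · rintro (h | h)
      · rw [h.1, if_pos (by omega)]; omega
      · rw [h.1, if_pos (by omega)]; omega
  have hm := hd m
  set u := d m
  set v := d (m - 1)
  -- The new boxes are at position `u` on the diagonal `m` and at position `v` on the diagonal `m -
  -- 1`. The profile leaves two values for `v`: in this case the second box is directly below the
  -- first, otherwise directly to its left.
  by_cases hcase : (m ≤ 0 ∧ v = u) ∨ (1 ≤ m ∧ v = u + 1)
  · refine Or.inr ⟨u + (-m).toNat, u + m.toNat, ?_, by omega⟩
    ext ⟨i, j⟩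
    simp only [hs', Finset.mem_insert, Finset.mem_singleton, Prod.mk.injEq]
    omega
  · refine Or.inl ⟨v + (-(m - 1)).toNat, v + (m - 1).toNat, ?_, by omega⟩
    ext ⟨i, j⟩
    simp only [hs', Finset.mem_insert, Finset.mem_singleton, Prod.mk.injEq]
    omega

/-- The partial counts form a chain of profiles, that is, of diagrams, in which each step adds one
domino. The tableau records at which step a box appears. -/
theorem IsDominoHeadSeq.exists_tableau {n : ℕ} {μ : YoungDiagram} {h : ℕ → ℤ}
    (hh : IsDominoHeadSeq n μ h) : ∃ T : StandardDominoTableau n μ, T.heads = h := by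
  set D : ℕ → ℤ → ℕ := fun a k => headCount h a k + headCount h a (k + 1) with hDdef
  have hD : ∀ k, Monotone fun a => D a k := fun k =>
    (headCount_mono h k).add (headCount_mono h (k + 1))
  have h0 : ∀ k, D 0 k = 0 := fun k => by simp [D, headCount_zero]
  have hn : ∀ k, D n k = diagCard μ.cells k := hh.total
  have hp : ∀ a ≤ n, IsDiagProfile (D a) := hh.profile
  have hdom : ∀ a ∈ Set.Icc 1 n,
      IsHead (μ.cells.filter fun c => chainFilling D μ c.1 c.2 = a) (h a) := by
    rintro a ⟨ha1, han⟩
    obtain ⟨b, rfl⟩ : ∃ b, a = b + 1 := ⟨a - 1, by omega⟩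
    refine isHead_of_profile (d := D b) (d' := D (b + 1)) (hp b (by omega)) (fun k => ?_)
      fun i j => ?_
    · simp only [D, headCount_succ]
      split_ifs <;> omega
    · rw [← chainFilling_eq_succ_iff hD hn han, Finset.mem_filter, YoungDiagram.mem_cells]
  let T : StandardDominoTableau n μ :=
    { entry := chainFilling D μ
      entry_mem := fun i j hij => chainFilling_mem_Icc hD h0 hn hij
      isDomino := fun a ha => (hdom a ha).isDomino
      row_le := fun i j₁ j₂ hj hm => chainFilling_le_chainFilling hD h0 hn hp le_rfl hj.le hm
      col_le := fun i₁ i₂ j hi hm => chainFilling_le_chainFilling hD h0 hn hp hi.le le_rfl hm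
      zeros := fun i j hij => chainFilling_of_notMem hij }
  refine ⟨T, funext fun a => ?_⟩
  by_cases ha : a ∈ Set.Icc 1 n
  · exact (T.isHead_heads ha).unique (hdom a ha)
  · rw [hh.zero a ha, T.isDominoHeadSeq_heads.zero a ha]

/-! ### Bi-tableaux as head sequences -/

/-- Head sequences of the standard bi-tableaux of bi-shape `(μ, ν)`: the labels `a` with
`h a = 2 * k` are on the diagonal of content `k` of the first tableau, those with
`h a = 2 * k + 1` on the diagonal of content `k` of the second one. -/
structure IsPairHeadSeq (n : ℕ) (μ ν : YoungDiagram) (h : ℕ → ℤ) : Prop where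
  zero : ∀ a ∉ Set.Icc 1 n, h a = 0
  profile_fst : ∀ a ≤ n, IsDiagProfile fun k => headCount h a (2 * k)
  profile_snd : ∀ a ≤ n, IsDiagProfile fun k => headCount h a (2 * k + 1)
  total_fst : ∀ k, headCount h n (2 * k) = diagCard μ.cells k
  total_snd : ∀ k, headCount h n (2 * k + 1) = diagCard ν.cells k

/-- A filling of `μ` puts the labels `a` with `h a = f k` on the diagonal of content `k`. -/
theorem diagCard_filter_le_eq_headCount {n : ℕ} {μ : YoungDiagram} {e : ℕ → ℕ → ℕ} {h : ℕ → ℤ}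
    {f : ℤ → ℤ} (hmem : ∀ i j, (i, j) ∈ μ → e i j ∈ Set.Icc 1 n)
    (hf : ∀ i j : ℕ, (i, j) ∈ μ → h (e i j) = f ((j : ℤ) - i))
    (hinj : ∀ i j i' j', (i, j) ∈ μ → (i', j') ∈ μ → e i j = e i' j' → (i, j) = (i', j'))
    (hsurj : ∀ b ∈ Set.Icc 1 n, ∀ k, h b = f k →
      ∃ i j : ℕ, (i, j) ∈ μ ∧ e i j = b ∧ (j : ℤ) - i = k)
    {a : ℕ} (ha : a ≤ n) (k : ℤ) :
    diagCard (μ.cells.filter fun c => e c.1 c.2 ≤ a) k = headCount h a (f k) := by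
  refine Finset.card_bij (fun c _ => e c.1 c.2) ?_ ?_ ?_
  · rintro ⟨i, j⟩ hc
    simp only [Finset.mem_filter, YoungDiagram.mem_cells, Finset.mem_Icc] at hc ⊢
    exact ⟨⟨(hmem i j hc.1.1).1, hc.1.2⟩, by rw [hf i j hc.1.1, hc.2]⟩
  · rintro ⟨i, j⟩ hc ⟨i', j'⟩ hd hcd
    simp only [Finset.mem_filter, YoungDiagram.mem_cells] at hc hd
    exact hinj i j i' j' hc.1.1 hd.1.1 hcd
  · intro b hb
    simp only [Finset.mem_filter, Finset.mem_Icc] at hb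
    obtain ⟨i, j, hij, he, hk⟩ := hsurj b ⟨hb.1.1, hb.1.2.trans ha⟩ k hb.2
    exact ⟨(i, j), by simp [hij, he, hk, hb.1.2], he⟩

namespace StandardBiTableau

variable {n : ℕ} {μ ν : YoungDiagram}

theorem fst_mem_Icc (B : StandardBiTableau n μ ν) {i j : ℕ} (h : (i, j) ∈ μ) :
    B.fst i j ∈ Set.Icc 1 n :=
  B.bijOn.mapsTo (x := Sum.inl (i, j)) (by simpa using h)

theorem snd_mem_Icc (B : StandardBiTableau n μ ν) {i j : ℕ} (h : (i, j) ∈ ν) :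
    B.snd i j ∈ Set.Icc 1 n :=
  B.bijOn.mapsTo (x := Sum.inr (i, j)) (by simpa using h)

theorem fst_injOn (B : StandardBiTableau n μ ν) (i j i' j' : ℕ) (h : (i, j) ∈ μ)
    (h' : (i', j') ∈ μ) (he : B.fst i j = B.fst i' j') : (i, j) = (i', j') :=
  Sum.inl_injective <| B.bijOn.injOn (x₁ := Sum.inl (i, j)) (x₂ := Sum.inl (i', j'))
    (by simpa using h) (by simpa using h') he

theorem snd_injOn (B : StandardBiTableau n μ ν) (i j i' j' : ℕ) (h : (i, j) ∈ ν)
    (h' : (i', j') ∈ ν) (he : B.snd i j = B.snd i' j') : (i, j) = (i', j') :=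
  Sum.inr_injective <| B.bijOn.injOn (x₁ := Sum.inr (i, j)) (x₂ := Sum.inr (i', j'))
    (by simpa using h) (by simpa using h') he

theorem fst_ne_snd (B : StandardBiTableau n μ ν) {i j i' j' : ℕ} (h : (i, j) ∈ μ)
    (h' : (i', j') ∈ ν) : B.fst i j ≠ B.snd i' j' := fun he =>
  Sum.inl_ne_inr <| B.bijOn.injOn (x₁ := Sum.inl (i, j)) (x₂ := Sum.inr (i', j'))
    (by simpa using h) (by simpa using h') he

theorem exists_box (B : StandardBiTableau n μ ν) {a : ℕ} (ha : a ∈ Set.Icc 1 n) :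
    (∃ i j, B.FstAt a i j) ∨ ∃ i j, B.SndAt a i j := by
  obtain ⟨⟨i, j⟩ | ⟨i, j⟩, hx, rfl⟩ := B.bijOn.surjOn ha
  · exact Or.inl ⟨i, j, by simpa using hx, rfl⟩
  · exact Or.inr ⟨i, j, by simpa using hx, rfl⟩

/-- The head attached to the box of the label `a`. -/
def HasHead (B : StandardBiTableau n μ ν) (a : ℕ) (m : ℤ) : Prop :=
  (∃ i j : ℕ, B.FstAt a i j ∧ m = 2 * ((j : ℤ) - i)) ∨
    ∃ i j : ℕ, B.SndAt a i j ∧ m = 2 * ((j : ℤ) - i) + 1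

theorem HasHead.unique {B : StandardBiTableau n μ ν} {a : ℕ} {m m' : ℤ} (h : B.HasHead a m)
    (h' : B.HasHead a m') : m = m' := by
  rcases h with ⟨i, j, ⟨h1, h2⟩, rfl⟩ | ⟨i, j, ⟨h1, h2⟩, rfl⟩ <;>
    rcases h' with ⟨i', j', ⟨h1', h2'⟩, rfl⟩ | ⟨i', j', ⟨h1', h2'⟩, rfl⟩
  · obtain ⟨rfl, rfl⟩ := Prod.mk.inj (B.fst_injOn i j i' j' h1 h1' (h2.trans h2'.symm))
    rfl
  · exact absurd (h2.trans h2'.symm) (B.fst_ne_snd h1 h1')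
  · exact absurd (h2'.trans h2.symm) (B.fst_ne_snd h1' h1)
  · obtain ⟨rfl, rfl⟩ := Prod.mk.inj (B.snd_injOn i j i' j' h1 h1' (h2.trans h2'.symm))
    rfl

theorem exists_hasHead (B : StandardBiTableau n μ ν) {a : ℕ} (ha : a ∈ Set.Icc 1 n) :
    ∃ m, B.HasHead a m := by
  rcases B.exists_box ha with ⟨i, j, h⟩ | ⟨i, j, h⟩
  · exact ⟨_, Or.inl ⟨i, j, h, rfl⟩⟩
  · exact ⟨_, Or.inr ⟨i, j, h, rfl⟩⟩

/-- The heads attached to the labels of `B`. -/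
noncomputable def heads (B : StandardBiTableau n μ ν) (a : ℕ) : ℤ :=
  open Classical in if h : a ∈ Set.Icc 1 n then (B.exists_hasHead h).choose else 0

theorem hasHead_heads (B : StandardBiTableau n μ ν) {a : ℕ} (ha : a ∈ Set.Icc 1 n) :
    B.HasHead a (B.heads a) := by
  rw [heads, dif_pos ha]
  exact (B.exists_hasHead ha).choose_spec

theorem heads_fst (B : StandardBiTableau n μ ν) {i j : ℕ} (h : (i, j) ∈ μ) :
    B.heads (B.fst i j) = 2 * ((j : ℤ) - i) :=
  (B.hasHead_heads (B.fst_mem_Icc h)).unique (Or.inl ⟨i, j, ⟨h, rfl⟩, rfl⟩)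

theorem heads_snd (B : StandardBiTableau n μ ν) {i j : ℕ} (h : (i, j) ∈ ν) :
    B.heads (B.snd i j) = 2 * ((j : ℤ) - i) + 1 :=
  (B.hasHead_heads (B.snd_mem_Icc h)).unique (Or.inr ⟨i, j, ⟨h, rfl⟩, rfl⟩)

theorem exists_fstAt_of_heads_eq (B : StandardBiTableau n μ ν) {a : ℕ} (ha : a ∈ Set.Icc 1 n)
    {k : ℤ} (h : B.heads a = 2 * k) : ∃ i j : ℕ, B.FstAt a i j ∧ (j : ℤ) - i = k := by
  rcases B.hasHead_heads ha with ⟨i, j, hij, hm⟩ | ⟨i, j, hij, hm⟩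
  · exact ⟨i, j, hij, by omega⟩
  · omega

theorem exists_sndAt_of_heads_eq (B : StandardBiTableau n μ ν) {a : ℕ} (ha : a ∈ Set.Icc 1 n)
    {k : ℤ} (h : B.heads a = 2 * k + 1) : ∃ i j : ℕ, B.SndAt a i j ∧ (j : ℤ) - i = k := by
  rcases B.hasHead_heads ha with ⟨i, j, hij, hm⟩ | ⟨i, j, hij, hm⟩
  · omega
  · exact ⟨i, j, hij, by omega⟩

theorem diagCard_fst_filter_le (B : StandardBiTableau n μ ν) {a : ℕ} (ha : a ≤ n) (k : ℤ) :
    diagCard (μ.cells.filter fun c => B.fst c.1 c.2 ≤ a) k = headCount B.heads a (2 * k) :=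
  diagCard_filter_le_eq_headCount (f := fun k => 2 * k) (fun _ _ => B.fst_mem_Icc)
    (fun _ _ => B.heads_fst) B.fst_injOn
    (fun b hb k hk => by
      obtain ⟨i, j, hij, h⟩ := B.exists_fstAt_of_heads_eq hb hk
      exact ⟨i, j, hij.1, hij.2, h⟩) ha k

theorem diagCard_snd_filter_le (B : StandardBiTableau n μ ν) {a : ℕ} (ha : a ≤ n) (k : ℤ) :
    diagCard (ν.cells.filter fun c => B.snd c.1 c.2 ≤ a) k = headCount B.heads a (2 * k + 1) :=
  diagCard_filter_le_eq_headCount (f := fun k => 2 * k + 1) (fun _ _ => B.snd_mem_Icc)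
    (fun _ _ => B.heads_snd) B.snd_injOn
    (fun b hb k hk => by
      obtain ⟨i, j, hij, h⟩ := B.exists_sndAt_of_heads_eq hb hk
      exact ⟨i, j, hij.1, hij.2, h⟩) ha k

theorem isLowerSet_fst (B : StandardBiTableau n μ ν) (a : ℕ) :
    IsLowerSet ((μ.cells.filter fun c => B.fst c.1 c.2 ≤ a : Finset (ℕ × ℕ)) : Set (ℕ × ℕ)) :=
  isLowerSet_filter_le (fun i j₁ j₂ h h' => (B.fst_row_lt i j₁ j₂ h h').le)
    (fun i₁ i₂ j h h' => (B.fst_col_lt i₁ i₂ j h h').le) a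

theorem isLowerSet_snd (B : StandardBiTableau n μ ν) (a : ℕ) :
    IsLowerSet ((ν.cells.filter fun c => B.snd c.1 c.2 ≤ a : Finset (ℕ × ℕ)) : Set (ℕ × ℕ)) :=
  isLowerSet_filter_le (fun i j₁ j₂ h h' => (B.snd_row_lt i j₁ j₂ h h').le)
    (fun i₁ i₂ j h h' => (B.snd_col_lt i₁ i₂ j h h').le) a

theorem isPairHeadSeq_heads (B : StandardBiTableau n μ ν) : IsPairHeadSeq n μ ν B.heads where
  zero a ha := dif_neg ha
  profile_fst a ha := by
    have := isDiagProfile_diagCard (B.isLowerSet_fst a)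
    rwa [funext (B.diagCard_fst_filter_le ha)] at this
  profile_snd a ha := by
    have := isDiagProfile_diagCard (B.isLowerSet_snd a)
    rwa [funext (B.diagCard_snd_filter_le ha)] at this
  total_fst k := by
    rw [← B.diagCard_fst_filter_le le_rfl]
    congr 1
    exact Finset.filter_true_of_mem fun c hc => (B.fst_mem_Icc hc).2
  total_snd k := by
    rw [← B.diagCard_snd_filter_le le_rfl]
    congr 1
    exact Finset.filter_true_of_mem fun c hc => (B.snd_mem_Icc hc).2

theorem heads_injective : Function.Injective (heads : StandardBiTableau n μ ν → ℕ → ℤ) := by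
  intro B B' h
  have key_fst : ∀ a ≤ n, ∀ i j, (i, j) ∈ μ → (B.fst i j ≤ a ↔ B'.fst i j ≤ a) := by
    intro a ha i j hij
    have h1 := mem_iff_min_lt_diagCard (B.isLowerSet_fst a) i j
    have h2 := mem_iff_min_lt_diagCard (B'.isLowerSet_fst a) i j
    rw [B.diagCard_fst_filter_le ha, h, ← B'.diagCard_fst_filter_le ha, ← h2] at h1
    simpa [hij] using h1
  have key_snd : ∀ a ≤ n, ∀ i j, (i, j) ∈ ν → (B.snd i j ≤ a ↔ B'.snd i j ≤ a) := by
    intro a ha i j hij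
    have h1 := mem_iff_min_lt_diagCard (B.isLowerSet_snd a) i j
    have h2 := mem_iff_min_lt_diagCard (B'.isLowerSet_snd a) i j
    rw [B.diagCard_snd_filter_le ha, h, ← B'.diagCard_snd_filter_le ha, ← h2] at h1
    simpa [hij] using h1
  ext i j
  · by_cases hij : (i, j) ∈ μ
    · exact le_antisymm ((key_fst _ (B'.fst_mem_Icc hij).2 i j hij).2 le_rfl)
        ((key_fst _ (B.fst_mem_Icc hij).2 i j hij).1 le_rfl)
    · rw [B.fst_zeros i j hij, B'.fst_zeros i j hij]
  · by_cases hij : (i, j) ∈ ν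
    · exact le_antisymm ((key_snd _ (B'.snd_mem_Icc hij).2 i j hij).2 le_rfl)
        ((key_snd _ (B.snd_mem_Icc hij).2 i j hij).1 le_rfl)
    · rw [B.snd_zeros i j hij, B'.snd_zeros i j hij]

end StandardBiTableau

section chainFilling

variable {h : ℕ → ℤ} {f : ℤ → ℤ} {μ : YoungDiagram} {n : ℕ}

/-- The filling of `μ` in which the labels `a` with `h a = f k` are on the diagonal `k`. -/
theorem chainFilling_headCount_eq_succ_iff
    (hn : ∀ k, headCount h n (f k) = diagCard μ.cells k) {i j b : ℕ} (hb : b + 1 ≤ n) :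
    (i, j) ∈ μ ∧ chainFilling (fun a k => headCount h a (f k)) μ i j = b + 1 ↔
      h (b + 1) = f ((j : ℤ) - i) ∧ min i j = headCount h b (f ((j : ℤ) - i)) := by
  rw [chainFilling_eq_succ_iff (fun k => headCount_mono h (f k)) hn hb, headCount_succ]
  split_ifs <;> omega

theorem chainFilling_headCount_mem_Icc (hn : ∀ k, headCount h n (f k) = diagCard μ.cells k)
    {i j : ℕ} (hij : (i, j) ∈ μ) :
    chainFilling (fun a k => headCount h a (f k)) μ i j ∈ Set.Icc 1 n :=
  chainFilling_mem_Icc (fun k => headCount_mono h (f k)) (fun _ => headCount_zero h _) hn hij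

theorem head_chainFilling_headCount (hn : ∀ k, headCount h n (f k) = diagCard μ.cells k)
    {i j : ℕ} (hij : (i, j) ∈ μ) :
    h (chainFilling (fun a k => headCount h a (f k)) μ i j) = f ((j : ℤ) - i) := by
  obtain ⟨h1, h2⟩ := chainFilling_headCount_mem_Icc hn hij
  obtain ⟨b, hb⟩ := Nat.exists_eq_add_of_le' h1
  rw [hb] at h2 ⊢
  exact ((chainFilling_headCount_eq_succ_iff hn h2).1 ⟨hij, hb⟩).1

theorem chainFilling_headCount_injOn (hf : Function.Injective f)
    (hn : ∀ k, headCount h n (f k) = diagCard μ.cells k)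
    {i j i' j' : ℕ} (hij : (i, j) ∈ μ) (hij' : (i', j') ∈ μ)
    (he : chainFilling (fun a k => headCount h a (f k)) μ i j =
      chainFilling (fun a k => headCount h a (f k)) μ i' j') : i = i' ∧ j = j' := by
  obtain ⟨h1, h2⟩ := chainFilling_headCount_mem_Icc hn hij
  obtain ⟨b, hb⟩ := Nat.exists_eq_add_of_le' h1
  rw [hb] at h2
  have h3 := (chainFilling_headCount_eq_succ_iff hn h2).1 ⟨hij, hb⟩
  have h4 := (chainFilling_headCount_eq_succ_iff hn h2).1 ⟨hij', he ▸ hb⟩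
  have h5 := hf (h3.1.symm.trans h4.1)
  rw [h5] at h3
  omega

theorem chainFilling_headCount_lt (hf : Function.Injective f)
    (hn : ∀ k, headCount h n (f k) = diagCard μ.cells k)
    (hp : ∀ a ≤ n, IsDiagProfile fun k => headCount h a (f k)) {i j i' j' : ℕ}
    (hi : i' ≤ i) (hj : j' ≤ j) (hne : i' ≠ i ∨ j' ≠ j) (hij : (i, j) ∈ μ) :
    chainFilling (fun a k => headCount h a (f k)) μ i' j' <
      chainFilling (fun a k => headCount h a (f k)) μ i j := by
  refine lt_of_le_of_ne (chainFilling_le_chainFilling (fun k => headCount_mono h (f k))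
    (fun _ => headCount_zero h _) hn hp hi hj hij) fun he => ?_
  have := chainFilling_headCount_injOn hf hn (μ.up_left_mem hi hj hij) hij he
  omega

theorem exists_chainFilling_headCount_eq (hn : ∀ k, headCount h n (f k) = diagCard μ.cells k)
    {a : ℕ} (ha : a ∈ Set.Icc 1 n) {k : ℤ} (hk : h a = f k) :
    ∃ i j : ℕ, (i, j) ∈ μ ∧ chainFilling (fun a k => headCount h a (f k)) μ i j = a := by
  obtain ⟨b, rfl⟩ := Nat.exists_eq_add_of_le' ha.1
  -- The box of the label `b + 1` is at the first free position of its diagonal: the number of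
  -- earlier labels placed there.
  set t := headCount h b (f k)
  have h1 : ((t + k.toNat : ℕ) : ℤ) - (t + (-k).toNat : ℕ) = k := by omega
  refine ⟨t + (-k).toNat, t + k.toNat, (chainFilling_headCount_eq_succ_iff hn ha.2).2 ?_⟩
  rw [h1]
  exact ⟨hk, by omega⟩

end chainFilling

theorem IsPairHeadSeq.exists_tableau {n : ℕ} {μ ν : YoungDiagram} {h : ℕ → ℤ}
    (hh : IsPairHeadSeq n μ ν h) : ∃ B : StandardBiTableau n μ ν, B.heads = h := by
  have hf : Function.Injective fun k : ℤ => 2 * k := fun a b hab => by simp only at hab; omega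
  have hg : Function.Injective fun k : ℤ => 2 * k + 1 := fun a b hab => by simp only at hab; omega
  have h1 : ∀ k, headCount h n ((fun k : ℤ => 2 * k) k) = diagCard μ.cells k := hh.total_fst
  have h2 : ∀ k, headCount h n ((fun k : ℤ => 2 * k + 1) k) = diagCard ν.cells k := hh.total_snd
  let B : StandardBiTableau n μ ν :=
    { fst := chainFilling (fun a k => headCount h a ((fun k : ℤ => 2 * k) k)) μ
      snd := chainFilling (fun a k => headCount h a ((fun k : ℤ => 2 * k + 1) k)) ν
      bijOn := by
        refine ⟨?_, ?_, ?_⟩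
        · rintro (⟨i, j⟩ | ⟨i, j⟩) hx
          · exact chainFilling_headCount_mem_Icc h1 (by simpa using hx)
          · exact chainFilling_headCount_mem_Icc h2 (by simpa using hx)
        · rintro (⟨i, j⟩ | ⟨i, j⟩) hx (⟨i', j'⟩ | ⟨i', j'⟩) hy hxy <;>
            simp only [Finset.mem_coe, Finset.inl_mem_disjSum, Finset.inr_mem_disjSum,
              YoungDiagram.mem_cells, Sum.elim_inl, Sum.elim_inr] at hx hy hxy
          · obtain ⟨rfl, rfl⟩ := chainFilling_headCount_injOn hf h1 hx hy hxy
            rfl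
          -- A label used in both tableaux would have a head that is both even and odd.
          · have h3 := head_chainFilling_headCount h1 hx
            have h4 := head_chainFilling_headCount h2 hy
            rw [hxy, h4] at h3
            omega
          · have h3 := head_chainFilling_headCount h2 hx
            have h4 := head_chainFilling_headCount h1 hy
            rw [hxy, h4] at h3
            omega
          · obtain ⟨rfl, rfl⟩ := chainFilling_headCount_injOn hg h2 hx hy hxy
            rfl
        · intro a ha
          obtain ⟨k, hk | hk⟩ : ∃ k, h a = 2 * k ∨ h a = 2 * k + 1 := ⟨h a / 2, by omega⟩
          · obtain ⟨i, j, hij, he⟩ := exists_chainFilling_headCount_eq h1 ha hk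
            exact ⟨Sum.inl (i, j), by simpa using hij, he⟩
          · obtain ⟨i, j, hij, he⟩ := exists_chainFilling_headCount_eq h2 ha hk
            exact ⟨Sum.inr (i, j), by simpa using hij, he⟩
      fst_row_lt := fun i j₁ j₂ hj hm =>
        chainFilling_headCount_lt hf h1 hh.profile_fst le_rfl hj.le (Or.inr hj.ne) hm
      fst_col_lt := fun i₁ i₂ j hi hm =>
        chainFilling_headCount_lt hf h1 hh.profile_fst hi.le le_rfl (Or.inl hi.ne) hm
      snd_row_lt := fun i j₁ j₂ hj hm =>
        chainFilling_headCount_lt hg h2 hh.profile_snd le_rfl hj.le (Or.inr hj.ne) hm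
      snd_col_lt := fun i₁ i₂ j hi hm =>
        chainFilling_headCount_lt hg h2 hh.profile_snd hi.le le_rfl (Or.inl hi.ne) hm
      fst_zeros := fun i j hij => chainFilling_of_notMem hij
      snd_zeros := fun i j hij => chainFilling_of_notMem hij }
  refine ⟨B, funext fun a => ?_⟩
  by_cases ha : a ∈ Set.Icc 1 n
  · rcases B.exists_box ha with ⟨i, j, hij, rfl⟩ | ⟨i, j, hij, rfl⟩
    · rw [B.heads_fst hij]
      exact (head_chainFilling_headCount h1 hij).symm
    · rw [B.heads_snd hij]
      exact (head_chainFilling_headCount h2 hij).symm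
  · rw [hh.zero a ha, B.isPairHeadSeq_heads.zero a ha]

/-! ### Descents of domino tableaux in terms of heads -/

/-- Two dominoes added one after the other to a diagram: the second one is strictly below the first
one exactly if its head has smaller content. -/
theorem IsHead.forall_lt_iff {A B : Finset (ℕ × ℕ)} {m m' : ℤ} (hA : IsHead A m) (hB : IsHead B m')
    (hnle : ∀ i j i' j', (i, j) ∈ A → (i', j') ∈ B → i' ≤ i → j' ≤ j → False)
    (hconv : ∀ i j i' j' a b, (i, j) ∈ A → (i', j') ∈ B → i ≤ a → a ≤ i' → j ≤ b → b ≤ j' →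
      (a, b) ∈ A ∨ (a, b) ∈ B) :
    (∀ c ∈ A, ∀ d ∈ B, c.1 < d.1) ↔ m' < m := by
  rcases hA with ⟨r, c, rfl, rfl⟩ | ⟨r, c, rfl, rfl⟩ <;>
    rcases hB with ⟨r', c', rfl, rfl⟩ | ⟨r', c', rfl, rfl⟩
  · have h1 := hnle r (c + 1) r' c' (by simp) (by simp)
    have h2 := hconv r c r' c' (r + 1) c (by simp) (by simp) (by omega)
    have h3 := hconv r c r' c' (r + 1) (c + 1) (by simp) (by simp) (by omega)
    simp at h1 h2 h3 ⊢
    omega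
  · have h1 := hnle r (c + 1) r' c' (by simp) (by simp)
    have h2 := hconv r c r' c' (r + 1) c (by simp) (by simp) (by omega)
    have h3 := hconv r c r' c' (r + 1) (c + 1) (by simp) (by simp) (by omega)
    simp at h1 h2 h3 ⊢
    omega
  · have h1 := hnle (r + 1) c r' c' (by simp) (by simp)
    have h2 := hconv r c r' c' (r + 1) (c + 1) (by simp) (by simp) (by omega)
    simp at h1 h2 ⊢
    omega
  · have h1 := hnle (r + 1) c r' c' (by simp) (by simp)
    have h2 := hconv r c r' c' (r + 1) (c + 1) (by simp) (by simp) (by omega)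
    simp at h1 h2 ⊢
    omega

namespace StandardDominoTableau

variable {n : ℕ} {μ : YoungDiagram}

theorem entry_le_entry (T : StandardDominoTableau n μ) {i j i' j' : ℕ} (hi : i' ≤ i) (hj : j' ≤ j)
    (h : (i, j) ∈ μ) : T.entry i' j' ≤ T.entry i j := by
  have := isLowerSet_filter_le T.row_le T.col_le (T.entry i j) (Prod.mk_le_mk.2 ⟨hi, hj⟩)
    (by simpa using h)
  simpa using And.right (by simpa using this)

/-- The domino `1` covers the corner, so its head is `0` if it is vertical and `1` if it is
horizontal. The condition `1 ≤ n` excludes the default value `0` of `heads`. -/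
theorem isVerticalDomino_domino_one_iff (T : StandardDominoTableau n μ) :
    IsVerticalDomino (T.domino 1) ↔ 1 ≤ n ∧ T.heads 1 = 0 := by
  have h00 : ∀ c ∈ T.domino 1, (0, 0) ∈ T.domino 1 := by
    rintro ⟨i, j⟩ hc
    rw [mem_domino] at hc ⊢
    have h0 := μ.up_left_mem (Nat.zero_le i) (Nat.zero_le j) hc.1
    exact ⟨h0, le_antisymm ((T.entry_le_entry (Nat.zero_le i) (Nat.zero_le j) hc.1).trans_eq hc.2)
      (T.entry_mem 0 0 h0).1⟩
  constructor
  · rintro ⟨i, j, h⟩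
    have hmem : (i, j) ∈ T.domino 1 := by simp [h]
    have hn : 1 ≤ n := by
      have h1 := mem_domino.1 hmem
      exact h1.2 ▸ (T.entry_mem i j h1.1).2
    refine ⟨hn, ?_⟩
    rw [(T.isHead_heads ⟨le_rfl, hn⟩).unique (Or.inr ⟨i, j, h, rfl⟩)]
    have := h00 _ hmem
    simp only [h, Finset.mem_insert, Finset.mem_singleton, Prod.mk.injEq] at this
    omega
  · rintro ⟨hn, h0⟩
    have hh := T.isHead_heads ⟨le_rfl, hn⟩
    obtain ⟨x, y, hxy, -⟩ := hh.eq_pair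
    have hmem := h00 x (by simp [hxy])
    rcases hh with ⟨r, c, h, hm⟩ | ⟨r, c, h, -⟩
    · simp only [h, Finset.mem_insert, Finset.mem_singleton, Prod.mk.injEq] at hmem
      omega
    · exact ⟨r, c, h⟩

/-- Entries weakly increase, so a box between the dominoes `i` and `i + 1` carries one of these two
labels; this is the convexity needed to compare the dominoes by their heads. -/
theorem mem_Des_iff (T : StandardDominoTableau n μ) (i : ℕ) :
    i ∈ T.Des ↔ i + 1 ≤ n ∧ ((i = 0 ∧ T.heads 1 = 0) ∨ (1 ≤ i ∧ T.heads (i + 1) < T.heads i)) := by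
  have key : 1 ≤ i → i + 1 ≤ n → ((∀ c ∈ T.domino i, ∀ d ∈ T.domino (i + 1), c.1 < d.1) ↔
      T.heads (i + 1) < T.heads i) := by
    intro h1 hn
    refine (T.isHead_heads ⟨h1, by omega⟩).forall_lt_iff (T.isHead_heads ⟨by omega, hn⟩) ?_ ?_
    · intro a b a' b' h h' ha hb
      rw [mem_domino] at h h'
      have := T.entry_le_entry ha hb h.1
      simp only at h h'
      omega
    · intro a b a' b' a'' b'' h h' ha ha' hb hb'
      rw [mem_domino] at h h'
      have hm := μ.up_left_mem ha' hb' h'.1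
      have h1 := T.entry_le_entry ha hb hm
      have h2 := T.entry_le_entry ha' hb' h'.1
      simp only [mem_domino, hm, true_and] at h h' ⊢
      omega
  simp only [Des, Set.mem_union, Set.mem_ofPred_eq, isVerticalDomino_domino_one_iff]
  constructor
  · rintro (⟨h1, h2, h3⟩ | ⟨rfl, h1, h2⟩)
    · exact ⟨h2, Or.inr ⟨h1, (key h1 h2).1 h3⟩⟩
    · exact ⟨h1, Or.inl ⟨rfl, h2⟩⟩
  · rintro ⟨hn, ⟨rfl, h⟩ | ⟨h1, h⟩⟩
    · exact Or.inr ⟨rfl, hn, h⟩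
    · exact Or.inl ⟨h1, hn, (key h1 hn).2 h⟩

end StandardDominoTableau

/-! ### Bi-tableaux as linear extensions with two labellings -/

/-- The boxes of a pair of diagrams, together with a smallest element. -/
abbrev PairBox (μ ν : YoungDiagram) : Type :=
  Option (μ.cells ⊕ ν.cells)

/-- Neighbouring boxes of one of the two diagrams; the additional element is the neighbour of the
two corners. -/
inductive PairBox.Adj {μ ν : YoungDiagram} : PairBox μ ν → PairBox μ ν → Prop
  | fst_corner (h : (0, 0) ∈ μ.cells) : Adj none (some (Sum.inl ⟨(0, 0), h⟩))
  | snd_corner (h : (0, 0) ∈ ν.cells) : Adj none (some (Sum.inr ⟨(0, 0), h⟩))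
  | fst_row (i j : ℕ) (h : (i, j) ∈ μ.cells) (h' : (i, j + 1) ∈ μ.cells) :
      Adj (some (Sum.inl ⟨(i, j), h⟩)) (some (Sum.inl ⟨(i, j + 1), h'⟩))
  | fst_col (i j : ℕ) (h : (i, j) ∈ μ.cells) (h' : (i + 1, j) ∈ μ.cells) :
      Adj (some (Sum.inl ⟨(i, j), h⟩)) (some (Sum.inl ⟨(i + 1, j), h'⟩))
  | snd_row (i j : ℕ) (h : (i, j) ∈ ν.cells) (h' : (i, j + 1) ∈ ν.cells) :
      Adj (some (Sum.inr ⟨(i, j), h⟩)) (some (Sum.inr ⟨(i, j + 1), h'⟩))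
  | snd_col (i j : ℕ) (h : (i, j) ∈ ν.cells) (h' : (i + 1, j) ∈ ν.cells) :
      Adj (some (Sum.inr ⟨(i, j), h⟩)) (some (Sum.inr ⟨(i + 1, j), h'⟩))

namespace PairBox

variable {μ ν : YoungDiagram}

/-- The labelling of the boxes by the contents of the corresponding domino heads. -/
def headKey : PairBox μ ν → ℤ ×ₗ ℤ
  -- Heads are doubled to `4 * k` and `4 * k + 2` so that `1` fits strictly between the keys `0` and
  -- `2` of the two corners: `0` is a descent exactly if the label `1` is in the first tableau. The
  -- row only separates boxes of one diagonal.
  | none => toLex (1, 0)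
  | some (Sum.inl c) => toLex (4 * ((c.1.2 : ℤ) - c.1.1), (c.1.1 : ℤ))
  | some (Sum.inr c) => toLex (4 * ((c.1.2 : ℤ) - c.1.1) + 2, (c.1.1 : ℤ))

/-- The labelling of the boxes by rows, from the last row of `μ` to the first row of `ν`. -/
def rowKey : PairBox μ ν → ℤ ×ₗ ℤ ×ₗ ℤ
  | none => toLex (0, toLex (0, 0))
  | some (Sum.inl c) => toLex (-1, toLex (-(c.1.1 : ℤ), (c.1.2 : ℤ)))
  | some (Sum.inr c) => toLex (1, toLex (-(c.1.1 : ℤ), (c.1.2 : ℤ)))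

theorem headKey_injective : Function.Injective (headKey : PairBox μ ν → ℤ ×ₗ ℤ) := by
  rintro (_ | ⟨⟨i, j⟩, h⟩ | ⟨⟨i, j⟩, h⟩) (_ | ⟨⟨i', j'⟩, h'⟩ | ⟨⟨i', j'⟩, h'⟩) hk <;>
    simp only [headKey, EmbeddingLike.apply_eq_iff_eq, Prod.mk.injEq] at hk <;> try omega
  · rfl
  · obtain rfl : i = i' := by omega
    obtain rfl : j = j' := by omega
    rfl
  · obtain rfl : i = i' := by omega
    obtain rfl : j = j' := by omega
    rfl

theorem rowKey_injective : Function.Injective (rowKey : PairBox μ ν → ℤ ×ₗ ℤ ×ₗ ℤ) := by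
  rintro (_ | ⟨⟨i, j⟩, h⟩ | ⟨⟨i, j⟩, h⟩) (_ | ⟨⟨i', j'⟩, h'⟩ | ⟨⟨i', j'⟩, h'⟩) hk <;>
    simp only [rowKey, EmbeddingLike.apply_eq_iff_eq, Prod.mk.injEq] at hk <;> try omega
  · rfl
  · obtain rfl : i = i' := by omega
    obtain rfl : j = j' := by omega
    rfl
  · obtain rfl : i = i' := by omega
    obtain rfl : j = j' := by omega
    rfl

/-- Both keys increase along rows, decrease down columns, and put the additional element above the
corner of `μ` and below that of `ν`. They may differ on boxes that are not neighbours. -/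
theorem Adj.headKey_lt_iff {x y : PairBox μ ν} (h : Adj x y) :
    headKey x < headKey y ↔ rowKey x < rowKey y := by
  cases h <;> simp only [headKey, rowKey, Prod.Lex.toLex_lt_toLex] <;>
    push_cast <;>
    simp only [or_false, false_or, true_and, and_false] <;> omega

/-- A linear extension gives its smallest value to the additional element. -/
theorem apply_none {N : ℕ} (L : PairBox μ ν ≃ Fin (N + 1)) (hL : ∀ x y, Adj x y → L x < L y) :
    L none = 0 := by
  have hpred : ∀ y : μ.cells ⊕ ν.cells, ∃ x, Adj x (some y) := by
    rintro (⟨⟨i, j⟩, h⟩ | ⟨⟨i, j⟩, h⟩)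
    · rcases i with _ | i
      · rcases j with _ | j
        · exact ⟨_, .fst_corner h⟩
        · exact ⟨_, .fst_row 0 j (μ.up_left_mem le_rfl (Nat.le_succ j) h) h⟩
      · exact ⟨_, .fst_col i j (μ.up_left_mem (Nat.le_succ i) le_rfl h) h⟩
    · rcases i with _ | i
      · rcases j with _ | j
        · exact ⟨_, .snd_corner h⟩
        · exact ⟨_, .snd_row 0 j (ν.up_left_mem le_rfl (Nat.le_succ j) h) h⟩
      · exact ⟨_, .snd_col i j (ν.up_left_mem (Nat.le_succ i) le_rfl h) h⟩
  obtain ⟨x, hx⟩ := L.surjective 0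
  rcases x with _ | y
  · exact hx
  · obtain ⟨x, hxy⟩ := hpred y
    have := hL _ _ hxy
    rw [hx] at this
    exact absurd this (Fin.not_lt_zero _)

end PairBox

/-- `PairBox.Adj` relates only neighbours; chaining recovers strict growth along whole rows and
columns. -/
theorem lt_of_forall_lt_succ {s : ℕ → Prop} {f : ℕ → ℕ} (hs : ∀ j, s (j + 1) → s j)
    (hf : ∀ j, s (j + 1) → f j < f (j + 1)) {a b : ℕ} (hab : a < b) (hb : s b) : f a < f b := by
  induction b, hab using Nat.le_induction with
  | base => exact hf a hb
  | succ b _ ih => exact (ih (hs b hb)).trans (hf b hb)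

namespace StandardBiTableau

variable {n : ℕ} {μ ν : YoungDiagram}

/-- The label of a box, the additional element being labelled `0`. -/
def label (B : StandardBiTableau n μ ν) : PairBox μ ν → Fin (n + 1)
  | none => 0
  | some (Sum.inl c) => ⟨B.fst c.1.1 c.1.2, Nat.lt_succ_of_le (B.fst_mem_Icc c.2).2⟩
  | some (Sum.inr c) => ⟨B.snd c.1.1 c.1.2, Nat.lt_succ_of_le (B.snd_mem_Icc c.2).2⟩

theorem label_bijective (B : StandardBiTableau n μ ν) : Function.Bijective B.label := by
  constructor
  · rintro (_ | ⟨⟨i, j⟩, h⟩ | ⟨⟨i, j⟩, h⟩) (_ | ⟨⟨i', j'⟩, h'⟩ | ⟨⟨i', j'⟩, h'⟩) he <;>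
      simp only [label, Fin.ext_iff, Fin.val_zero] at he
    · rfl
    · have := (B.fst_mem_Icc h').1
      omega
    · have := (B.snd_mem_Icc h').1
      omega
    · have := (B.fst_mem_Icc h).1
      omega
    · obtain ⟨rfl, rfl⟩ := Prod.mk.inj (B.fst_injOn i j i' j' h h' he)
      rfl
    · exact absurd he (B.fst_ne_snd h h')
    · have := (B.snd_mem_Icc h).1
      omega
    · exact absurd he.symm (B.fst_ne_snd h' h)
    · obtain ⟨rfl, rfl⟩ := Prod.mk.inj (B.snd_injOn i j i' j' h h' he)
      rfl
  · rintro ⟨a, ha⟩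
    rcases Nat.eq_zero_or_pos a with rfl | h0
    · exact ⟨none, rfl⟩
    · rcases B.exists_box (a := a) ⟨h0, by omega⟩ with ⟨i, j, hij, rfl⟩ | ⟨i, j, hij, rfl⟩
      · exact ⟨some (Sum.inl ⟨(i, j), hij⟩), rfl⟩
      · exact ⟨some (Sum.inr ⟨(i, j), hij⟩), rfl⟩

/-- A standard bi-tableau as a linear extension. -/
noncomputable def toLinExt (B : StandardBiTableau n μ ν) :
    LinExt (PairBox.Adj (μ := μ) (ν := ν)) (n + 1) :=
  ⟨Equiv.ofBijective B.label B.label_bijective, by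
    intro x y h
    simp only [Equiv.ofBijective_apply]
    cases h with
    | fst_corner h => exact (B.fst_mem_Icc h).1
    | snd_corner h => exact (B.snd_mem_Icc h).1
    | fst_row i j h h' => exact B.fst_row_lt _ _ _ (Nat.lt_succ_self j) h'
    | fst_col i j h h' => exact B.fst_col_lt _ _ _ (Nat.lt_succ_self i) h'
    | snd_row i j h h' => exact B.snd_row_lt _ _ _ (Nat.lt_succ_self j) h'
    | snd_col i j h h' => exact B.snd_col_lt _ _ _ (Nat.lt_succ_self i) h'⟩

theorem toLinExt_apply (B : StandardBiTableau n μ ν) (x : PairBox μ ν) :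
    B.toLinExt.1 x = B.label x := rfl

theorem toLinExt_injective :
    Function.Injective (toLinExt : StandardBiTableau n μ ν → LinExt _ (n + 1)) := by
  intro B B' h
  have key : ∀ x, B.label x = B'.label x := fun x => by
    rw [← toLinExt_apply, ← toLinExt_apply, h]
  ext i j
  · by_cases hij : (i, j) ∈ μ
    · exact congrArg Fin.val (key (some (Sum.inl ⟨(i, j), hij⟩)))
    · rw [B.fst_zeros i j hij, B'.fst_zeros i j hij]
  · by_cases hij : (i, j) ∈ ν
    · exact congrArg Fin.val (key (some (Sum.inr ⟨(i, j), hij⟩)))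
    · rw [B.snd_zeros i j hij, B'.snd_zeros i j hij]

theorem toLinExt_surjective :
    Function.Surjective (toLinExt : StandardBiTableau n μ ν → LinExt _ (n + 1)) := by
  classical
  rintro ⟨L, hL⟩
  let f : ℕ → ℕ → ℕ := fun i j =>
    if h : (i, j) ∈ μ then L (some (Sum.inl ⟨(i, j), h⟩)) else 0
  let g : ℕ → ℕ → ℕ := fun i j =>
    if h : (i, j) ∈ ν then L (some (Sum.inr ⟨(i, j), h⟩)) else 0
  have hf : ∀ i j (h : (i, j) ∈ μ), f i j = L (some (Sum.inl ⟨(i, j), h⟩)) :=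
    fun i j h => dif_pos h
  have hg : ∀ i j (h : (i, j) ∈ ν), g i j = L (some (Sum.inr ⟨(i, j), h⟩)) :=
    fun i j h => dif_pos h
  have h0 := PairBox.apply_none L hL
  have hmem : ∀ x, ((L (some x) : Fin (n + 1)) : ℕ) ∈ Set.Icc 1 n := fun x => by
    have h1 : L (some x) ≠ 0 := fun h => Option.some_ne_none x (L.injective (h.trans h0.symm))
    have h2 := (L (some x)).2
    rw [Ne, Fin.ext_iff, Fin.val_zero] at h1
    exact ⟨by omega, by omega⟩
  have hinj : ∀ x y, ((L x : Fin (n + 1)) : ℕ) = L y → x = y := fun x y h =>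
    L.injective (Fin.ext h)
  let B : StandardBiTableau n μ ν :=
    { fst := f
      snd := g
      bijOn := by
        refine ⟨?_, ?_, ?_⟩
        · rintro (⟨i, j⟩ | ⟨i, j⟩) hx <;>
            simp only [Finset.mem_coe, Finset.inl_mem_disjSum, Finset.inr_mem_disjSum,
              YoungDiagram.mem_cells, Sum.elim_inl, Sum.elim_inr] at hx ⊢
          · rw [hf i j hx]
            exact hmem _
          · rw [hg i j hx]
            exact hmem _
        · rintro (⟨i, j⟩ | ⟨i, j⟩) hx (⟨i', j'⟩ | ⟨i', j'⟩) hy hxy <;>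
            simp only [Finset.mem_coe, Finset.inl_mem_disjSum, Finset.inr_mem_disjSum,
              YoungDiagram.mem_cells, Sum.elim_inl, Sum.elim_inr] at hx hy hxy
          · rw [hf i j hx, hf i' j' hy] at hxy
            simpa using hinj _ _ hxy
          · rw [hf i j hx, hg i' j' hy] at hxy
            simpa using hinj _ _ hxy
          · rw [hg i j hx, hf i' j' hy] at hxy
            simpa using hinj _ _ hxy
          · rw [hg i j hx, hg i' j' hy] at hxy
            simpa using hinj _ _ hxy
        · rintro a ⟨ha1, han⟩
          obtain ⟨x, hx⟩ := L.surjective ⟨a, by omega⟩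
          have hxa : ((L x : Fin (n + 1)) : ℕ) = a := by rw [hx]
          rcases x with _ | ⟨⟨i, j⟩, h⟩ | ⟨⟨i, j⟩, h⟩
          · rw [h0, Fin.val_zero] at hxa
            omega
          · exact ⟨Sum.inl (i, j), by simpa using h, (hf i j h).trans hxa⟩
          · exact ⟨Sum.inr (i, j), by simpa using h, (hg i j h).trans hxa⟩
      fst_row_lt := fun i j₁ j₂ hj hm =>
        lt_of_forall_lt_succ (s := fun j => (i, j) ∈ μ)
          (fun j h => μ.up_left_mem le_rfl (Nat.le_succ j) h)
          (fun j h => by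
            rw [hf i j (μ.up_left_mem le_rfl (Nat.le_succ j) h), hf i (j + 1) h]
            exact hL _ _ (.fst_row i j _ h)) hj hm
      fst_col_lt := fun i₁ i₂ j hi hm =>
        lt_of_forall_lt_succ (s := fun i => (i, j) ∈ μ) (f := fun i => f i j)
          (fun i h => μ.up_left_mem (Nat.le_succ i) le_rfl h)
          (fun i h => by
            rw [hf i j (μ.up_left_mem (Nat.le_succ i) le_rfl h), hf (i + 1) j h]
            exact hL _ _ (.fst_col i j _ h)) hi hm
      snd_row_lt := fun i j₁ j₂ hj hm =>
        lt_of_forall_lt_succ (s := fun j => (i, j) ∈ ν)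
          (fun j h => ν.up_left_mem le_rfl (Nat.le_succ j) h)
          (fun j h => by
            rw [hg i j (ν.up_left_mem le_rfl (Nat.le_succ j) h), hg i (j + 1) h]
            exact hL _ _ (.snd_row i j _ h)) hj hm
      snd_col_lt := fun i₁ i₂ j hi hm =>
        lt_of_forall_lt_succ (s := fun i => (i, j) ∈ ν) (f := fun i => g i j)
          (fun i h => ν.up_left_mem (Nat.le_succ i) le_rfl h)
          (fun i h => by
            rw [hg i j (ν.up_left_mem (Nat.le_succ i) le_rfl h), hg (i + 1) j h]
            exact hL _ _ (.snd_col i j _ h)) hi hm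
      fst_zeros := fun i j hij => dif_neg hij
      snd_zeros := fun i j hij => dif_neg hij }
  refine ⟨B, Subtype.ext (Equiv.ext ?_)⟩
  rintro (_ | ⟨⟨i, j⟩, h⟩ | ⟨⟨i, j⟩, h⟩)
  · exact h0.symm
  · exact Fin.ext (hf i j h)
  · exact Fin.ext (hg i j h)

theorem toLinExt_symm_of_fstAt {B : StandardBiTableau n μ ν} {a i j : ℕ} (h : B.FstAt a i j)
    (ha : a < n + 1) : B.toLinExt.1.symm ⟨a, ha⟩ = some (Sum.inl ⟨(i, j), h.1⟩) :=
  B.toLinExt.1.symm_apply_eq.2 (Fin.ext h.2.symm)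

theorem toLinExt_symm_of_sndAt {B : StandardBiTableau n μ ν} {a i j : ℕ} (h : B.SndAt a i j)
    (ha : a < n + 1) : B.toLinExt.1.symm ⟨a, ha⟩ = some (Sum.inr ⟨(i, j), h.1⟩) :=
  B.toLinExt.1.symm_apply_eq.2 (Fin.ext h.2.symm)

theorem toLinExt_symm_zero (B : StandardBiTableau n μ ν) (ha : 0 < n + 1) :
    B.toLinExt.1.symm ⟨0, ha⟩ = none :=
  B.toLinExt.1.symm_apply_eq.2 rfl

theorem fst_le_fst (B : StandardBiTableau n μ ν) {i j i' j' : ℕ} (hi : i' ≤ i) (hj : j' ≤ j)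
    (h : (i, j) ∈ μ) : B.fst i' j' ≤ B.fst i j := by
  have := B.isLowerSet_fst (B.fst i j) (Prod.mk_le_mk.2 ⟨hi, hj⟩) (by simpa using h)
  simpa using And.right (by simpa using this)

theorem snd_le_snd (B : StandardBiTableau n μ ν) {i j i' j' : ℕ} (hi : i' ≤ i) (hj : j' ≤ j)
    (h : (i, j) ∈ ν) : B.snd i' j' ≤ B.snd i j := by
  have := B.isLowerSet_snd (B.snd i j) (Prod.mk_le_mk.2 ⟨hi, hj⟩) (by simpa using h)
  simpa using And.right (by simpa using this)

theorem FstAt.eq_and_eq {B : StandardBiTableau n μ ν} {a i j i' j' : ℕ} (h : B.FstAt a i j)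
    (h' : B.FstAt a i' j') : i = i' ∧ j = j' :=
  Prod.mk.inj (B.fst_injOn i j i' j' h.1 h'.1 (h.2.trans h'.2.symm))

theorem SndAt.eq_and_eq {B : StandardBiTableau n μ ν} {a i j i' j' : ℕ} (h : B.SndAt a i j)
    (h' : B.SndAt a i' j') : i = i' ∧ j = j' :=
  Prod.mk.inj (B.snd_injOn i j i' j' h.1 h'.1 (h.2.trans h'.2.symm))

theorem FstAt.not_sndAt {B : StandardBiTableau n μ ν} {a i j i' j' : ℕ} (h : B.FstAt a i j) :
    ¬ B.SndAt a i' j' := fun h' => B.fst_ne_snd h.1 h'.1 (h.2.trans h'.2.symm)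

theorem FstAt.not_le {B : StandardBiTableau n μ ν} {a b i j i' j' : ℕ} (h : B.FstAt a i j)
    (h' : B.FstAt b i' j') (hab : a < b) : ¬ (i' ≤ i ∧ j' ≤ j) := by
  rintro ⟨hi, hj⟩
  have := B.fst_le_fst hi hj h.1
  rw [h.2, h'.2] at this
  omega

theorem SndAt.not_le {B : StandardBiTableau n μ ν} {a b i j i' j' : ℕ} (h : B.SndAt a i j)
    (h' : B.SndAt b i' j') (hab : a < b) : ¬ (i' ≤ i ∧ j' ≤ j) := by
  rintro ⟨hi, hj⟩
  have := B.snd_le_snd hi hj h.1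
  rw [h.2, h'.2] at this
  omega

theorem FstAt.corner {B : StandardBiTableau n μ ν} {i j : ℕ} (h : B.FstAt 1 i j) :
    i = 0 ∧ j = 0 := by
  have h0 := μ.up_left_mem (Nat.zero_le i) (Nat.zero_le j) h.1
  have h1 := B.fst_le_fst (Nat.zero_le i) (Nat.zero_le j) h.1
  have h2 := (B.fst_mem_Icc h0).1
  rw [h.2] at h1
  exact h.eq_and_eq ⟨h0, le_antisymm h1 h2⟩

theorem SndAt.corner {B : StandardBiTableau n μ ν} {i j : ℕ} (h : B.SndAt 1 i j) :
    i = 0 ∧ j = 0 := by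
  have h0 := ν.up_left_mem (Nat.zero_le i) (Nat.zero_le j) h.1
  have h1 := B.snd_le_snd (Nat.zero_le i) (Nat.zero_le j) h.1
  have h2 := (B.snd_mem_Icc h0).1
  rw [h.2] at h1
  exact h.eq_and_eq ⟨h0, le_antisymm h1 h2⟩

theorem FstAt.heads_eq {B : StandardBiTableau n μ ν} {a i j : ℕ} (h : B.FstAt a i j) :
    B.heads a = 2 * ((j : ℤ) - i) := by
  rw [← h.2, B.heads_fst h.1]

theorem SndAt.heads_eq {B : StandardBiTableau n μ ν} {a i j : ℕ} (h : B.SndAt a i j) :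
    B.heads a = 2 * ((j : ℤ) - i) + 1 := by
  rw [← h.2, B.heads_snd h.1]

theorem mem_descents_headKey_iff (B : StandardBiTableau n μ ν) (s : Fin n) :
    s ∈ LinExt.descents PairBox.headKey B.toLinExt.1 ↔
      ((s : ℕ) = 0 ∧ B.heads 1 = 0) ∨ (1 ≤ (s : ℕ) ∧ B.heads (s + 1) < B.heads s) := by
  obtain ⟨s, hs⟩ := s
  rw [LinExt.mem_descents, Fin.succ_mk, Fin.castSucc_mk]
  rcases Nat.eq_zero_or_pos s with rfl | h0
  · rw [toLinExt_symm_zero]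
    rcases B.exists_box (a := 1) ⟨le_rfl, by omega⟩ with ⟨i, j, h⟩ | ⟨i, j, h⟩
    · obtain ⟨rfl, rfl⟩ := h.corner
      simp [toLinExt_symm_of_fstAt h, h.heads_eq, PairBox.headKey, Prod.Lex.toLex_lt_toLex]
    · obtain ⟨rfl, rfl⟩ := h.corner
      simp [toLinExt_symm_of_sndAt h, h.heads_eq, PairBox.headKey, Prod.Lex.toLex_lt_toLex]
  · rcases B.exists_box (a := s) ⟨h0, by omega⟩ with ⟨i, j, h⟩ | ⟨i, j, h⟩ <;>
      rcases B.exists_box (a := s + 1) ⟨by omega, hs⟩ with ⟨i', j', h'⟩ | ⟨i', j', h'⟩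
    · have := h.not_le h' (Nat.lt_succ_self s)
      simp only [toLinExt_symm_of_fstAt h, toLinExt_symm_of_fstAt h', h.heads_eq, h'.heads_eq,
        PairBox.headKey, Prod.Lex.toLex_lt_toLex]
      omega
    · simp only [toLinExt_symm_of_fstAt h, toLinExt_symm_of_sndAt h', h.heads_eq, h'.heads_eq,
        PairBox.headKey, Prod.Lex.toLex_lt_toLex]
      omega
    · simp only [toLinExt_symm_of_sndAt h, toLinExt_symm_of_fstAt h', h.heads_eq, h'.heads_eq,
        PairBox.headKey, Prod.Lex.toLex_lt_toLex]
      omega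
    · have := h.not_le h' (Nat.lt_succ_self s)
      simp only [toLinExt_symm_of_sndAt h, toLinExt_symm_of_sndAt h', h.heads_eq, h'.heads_eq,
        PairBox.headKey, Prod.Lex.toLex_lt_toLex]
      omega

theorem mem_descents_rowKey_iff (B : StandardBiTableau n μ ν) (s : Fin n) :
    s ∈ LinExt.descents PairBox.rowKey B.toLinExt.1 ↔ (s : ℕ) ∈ B.DesR := by
  obtain ⟨s, hs⟩ := s
  rw [LinExt.mem_descents, Fin.succ_mk, Fin.castSucc_mk]
  simp only [DesR, Set.mem_union, Set.mem_ofPred_eq]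
  rcases Nat.eq_zero_or_pos s with rfl | h0
  · rw [toLinExt_symm_zero]
    rcases B.exists_box (a := 1) ⟨le_rfl, by omega⟩ with ⟨i, j, h⟩ | ⟨i, j, h⟩
    · have : ∃ i j, B.FstAt 1 i j := ⟨i, j, h⟩
      simp [toLinExt_symm_of_fstAt h, PairBox.rowKey, Prod.Lex.toLex_lt_toLex, this]
    · have : ¬ ∃ i j, B.FstAt 1 i j := fun ⟨i', j', h'⟩ => h'.not_sndAt h
      simp [toLinExt_symm_of_sndAt h, PairBox.rowKey, Prod.Lex.toLex_lt_toLex, this]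
  · have hs0 : s ≠ 0 := by omega
    have h1 : 1 ≤ s := h0
    have hs1 : s + 1 ≤ n := hs
    simp only [hs0, h1, hs1, true_and, false_and, or_false]
    rcases B.exists_box (a := s) ⟨h0, by omega⟩ with ⟨i, j, h⟩ | ⟨i, j, h⟩ <;>
      rcases B.exists_box (a := s + 1) ⟨by omega, hs⟩ with ⟨i', j', h'⟩ | ⟨i', j', h'⟩
    -- In a common row the larger label is further right, so only a change of row can give a
    -- descent.
    · have := h.not_le h' (Nat.lt_succ_self s)
      simp only [toLinExt_symm_of_fstAt h, toLinExt_symm_of_fstAt h', PairBox.rowKey,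
        Prod.Lex.toLex_lt_toLex, lt_self_iff_false, false_or, true_and]
      constructor
      · intro hlt
        exact Or.inl ⟨i, j, i', j', h, h', by omega⟩
      · rintro (⟨a, b, a', b', ha, hb, hab⟩ | ⟨a, b, a', b', ha, -⟩ | ⟨a, b, a', b', ha, -⟩)
        · have h3 := h.eq_and_eq ha
          have h4 := h'.eq_and_eq hb
          omega
        · exact absurd ha h.not_sndAt
        · exact absurd ha h.not_sndAt
    · simp only [toLinExt_symm_of_fstAt h, toLinExt_symm_of_sndAt h', PairBox.rowKey,
        Prod.Lex.toLex_lt_toLex]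
      constructor
      · omega
      · rintro (⟨a, b, a', b', -, hb, -⟩ | ⟨a, b, a', b', ha, -⟩ | ⟨a, b, a', b', ha, -⟩)
        · exact absurd h' hb.not_sndAt
        · exact absurd ha h.not_sndAt
        · exact absurd ha h.not_sndAt
    · simp only [toLinExt_symm_of_sndAt h, toLinExt_symm_of_fstAt h', PairBox.rowKey,
        Prod.Lex.toLex_lt_toLex]
      exact ⟨fun _ => Or.inr (Or.inr ⟨i, j, i', j', h, h'⟩), fun _ => by omega⟩
    · have := h.not_le h' (Nat.lt_succ_self s)
      simp only [toLinExt_symm_of_sndAt h, toLinExt_symm_of_sndAt h', PairBox.rowKey,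
        Prod.Lex.toLex_lt_toLex, lt_self_iff_false, false_or, true_and]
      constructor
      · intro hlt
        exact Or.inr (Or.inl ⟨i, j, i', j', h, h', by omega⟩)
      · rintro (⟨a, b, a', b', ha, -⟩ | ⟨a, b, a', b', ha, hb, hab⟩ | ⟨a, b, a', b', -, hb⟩)
        · exact absurd h ha.not_sndAt
        · have h3 := h.eq_and_eq ha
          have h4 := h'.eq_and_eq hb
          omega
        · exact absurd h' hb.not_sndAt

theorem succ_le_of_mem_DesR {B : StandardBiTableau n μ ν} {s : ℕ} (h : s ∈ B.DesR) :
    s + 1 ≤ n := by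
  rcases h with ⟨-, h, -⟩ | ⟨rfl, i, j, h⟩
  · exact h
  · rw [zero_add, ← h.2]
    exact (B.fst_mem_Icc h.1).2

/-- The descent sets `DesR` and those defined by the heads are equidistributed. -/
theorem exists_perm_DesR_eq (n : ℕ) (μ ν : YoungDiagram) :
    ∃ σ : StandardBiTableau n μ ν ≃ StandardBiTableau n μ ν, ∀ B s, s ∈ B.DesR ↔
      s + 1 ≤ n ∧ ((s = 0 ∧ (σ B).heads 1 = 0) ∨ (1 ≤ s ∧ (σ B).heads (s + 1) < (σ B).heads s)) := by
  obtain ⟨σ, hσ⟩ := LinExt.exists_perm_descents_eq (n := n) PairBox.rowKey_injective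
    PairBox.headKey_injective
    fun (x y : PairBox μ ν) (h : PairBox.Adj x y) => h.headKey_lt_iff.symm
  let e : StandardBiTableau n μ ν ≃ LinExt (PairBox.Adj (μ := μ) (ν := ν)) (n + 1) :=
    Equiv.ofBijective toLinExt ⟨toLinExt_injective, toLinExt_surjective⟩
  refine ⟨e.trans (σ.trans e.symm), fun B s => ?_⟩
  have he : ((e.trans (σ.trans e.symm)) B).toLinExt = σ B.toLinExt :=
    e.apply_symm_apply _
  by_cases hs : s + 1 ≤ n
  · have h1 := B.mem_descents_rowKey_iff ⟨s, hs⟩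
    have h2 := ((e.trans (σ.trans e.symm)) B).mem_descents_headKey_iff ⟨s, hs⟩
    rw [he, hσ, h1] at h2
    simpa [hs] using h2
  · exact ⟨fun h => absurd (succ_le_of_mem_DesR h) hs, fun h => absurd h.1 hs⟩

/-- Each domino has exactly one top rightmost box, and its content is the head; outside `1, …, n`
both sequences are `0`. This turns the definition of the 2-quotient into a statement about
sequences. -/
theorem isAssociated_iff_heads_eq {lam : YoungDiagram} (B : StandardBiTableau n μ ν)
    (T : StandardDominoTableau n lam) : B.IsAssociated T ↔ B.heads = T.heads := by
  have htop : ∀ a ∈ Set.Icc 1 n, (∃ r c : ℕ, (r, c) ∈ T.domino a ∧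
        (∀ d ∈ T.domino a, r ≤ d.1 ∧ d.2 ≤ c) ∧ (c : ℤ) - r = T.heads a) := by
    intro a ha
    rcases T.isHead_heads ha with ⟨r, c, h, hm⟩ | ⟨r, c, h, hm⟩
    · exact ⟨r, c + 1, by simp [h], by simp [h], by push_cast; omega⟩
    · exact ⟨r, c, by simp [h], by simp [h], by omega⟩
  constructor
  · intro h
    funext a
    by_cases ha : a ∈ Set.Icc 1 n
    · obtain ⟨r, c, h1, h2, h3⟩ := htop a ha
      obtain ⟨k, hk | hk⟩ : ∃ k, (c : ℤ) - r = 2 * k ∨ (c : ℤ) - r = 2 * k + 1 :=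
        ⟨((c : ℤ) - r) / 2, by omega⟩
      · obtain ⟨i, j, hij, hk'⟩ := (h a ha r c h1 h2 k).1 hk
        rw [hij.heads_eq]
        omega
      · obtain ⟨i, j, hij, hk'⟩ := (h a ha r c h1 h2 k).2 hk
        rw [hij.heads_eq]
        omega
    · rw [B.isPairHeadSeq_heads.zero a ha, T.isDominoHeadSeq_heads.zero a ha]
  · intro h a ha r c h1 h2 k
    obtain ⟨r', c', h1', h2', h3'⟩ := htop a ha
    have h4 := h2 _ h1'
    have h5 := h2' _ h1
    simp only at h4 h5
    rw [← h] at h3'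
    exact ⟨fun hk => B.exists_fstAt_of_heads_eq ha (by omega),
      fun hk => B.exists_sndAt_of_heads_eq ha (by omega)⟩

end StandardBiTableau

/-! ### Existence of domino tableaux, the 2-quotient and the bijection -/

/-- Extending a standard domino tableau by one domino with the largest label. -/
theorem StandardDominoTableau.exists_extension {n : ℕ} {μ ν : YoungDiagram} (hle : μ ≤ ν)
    (hd : IsDomino (ν.cells \ μ.cells)) (T : StandardDominoTableau n μ) :
    Nonempty (StandardDominoTableau (n + 1) ν) := by
  classical
  let e : ℕ → ℕ → ℕ := fun i j => if (i, j) ∈ μ then T.entry i j else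
    if (i, j) ∈ ν then n + 1 else 0
  have hle' : ∀ i j, (i, j) ∈ μ → (i, j) ∈ ν := fun i j h => hle h
  have hmono : ∀ i j i' j', i' ≤ i → j' ≤ j → (i, j) ∈ ν → e i' j' ≤ e i j := by
    intro i j i' j' hi hj h
    have h' := ν.up_left_mem hi hj h
    by_cases hμ : (i, j) ∈ μ
    · simp only [e, if_pos hμ, if_pos (μ.up_left_mem hi hj hμ)]
      exact T.entry_le_entry hi hj hμ
    · simp only [e, if_neg hμ, if_pos h, if_pos h']
      split_ifs with h1
      · exact (T.entry_mem i' j' h1).2.trans (Nat.le_succ n)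
      · exact le_rfl
  refine ⟨⟨e, fun i j h => ?_, fun a ha => ?_, fun i j₁ j₂ hj h => hmono _ _ _ _ le_rfl hj.le h,
    fun i₁ i₂ j hi h => hmono _ _ _ _ hi.le le_rfl h, fun i j h => ?_⟩⟩
  · by_cases hμ : (i, j) ∈ μ
    · simp only [e, if_pos hμ]
      exact ⟨(T.entry_mem i j hμ).1, (T.entry_mem i j hμ).2.trans (Nat.le_succ n)⟩
    · simp only [e, if_neg hμ, if_pos h]
      exact ⟨by omega, le_rfl⟩
  · by_cases han : a = n + 1
    · convert hd using 1
      ext ⟨i, j⟩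
      simp only [Finset.mem_filter, Finset.mem_sdiff, YoungDiagram.mem_cells, han]
      refine and_congr_right fun h => ?_
      by_cases hμ : (i, j) ∈ μ
      · have := (T.entry_mem i j hμ).2
        simp only [e, if_pos hμ, hμ, not_true_eq_false, iff_false]
        omega
      · simp [e, h, hμ]
    · convert T.isDomino a ⟨ha.1, by have := ha.2; omega⟩ using 1
      ext ⟨i, j⟩
      simp only [Finset.mem_filter, YoungDiagram.mem_cells]
      by_cases hμ : (i, j) ∈ μ
      · simp [e, hμ, hle' i j hμ]
      · by_cases hν : (i, j) ∈ ν
        · simp [e, hμ, hν, Ne.symm han]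
        · simp [hμ, hν]
  · have hμ : (i, j) ∉ μ := fun hμ => h (hle' i j hμ)
    simp only [e, if_neg hμ, if_neg h]

/-- Labelling the dominoes in the order in which they are added gives a tableau. Without one,
`IsTwoQuotient` would hold vacuously for every pair and uniqueness would fail. -/
theorem HasEmptyTwoCore.nonempty_tableau {μ : YoungDiagram} (h : HasEmptyTwoCore μ) :
    ∀ n, μ.card = 2 * n → Nonempty (StandardDominoTableau n μ) := by
  induction h with
  | bot =>
    intro n hn
    have h0 : n = 0 := by
      have : (⊥ : YoungDiagram).card = 0 := by simp [YoungDiagram.card]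
      omega
    subst h0
    exact ⟨⟨fun _ _ => 0, fun i j h => absurd h (YoungDiagram.notMem_bot _),
      fun a ha => by have := ha.1.trans ha.2; omega, fun _ _ _ _ _ => le_rfl,
      fun _ _ _ _ _ => le_rfl, fun _ _ _ => rfl⟩⟩
  | add_domino μ ν hle hd hμ ih =>
    intro n hn
    have h2 : (ν.cells \ μ.cells).card = 2 := by
      rcases hd with ⟨i, j, h⟩ | ⟨i, j, h⟩ <;> rw [h, Finset.card_pair (by simp)]
    have hsub : μ.cells ⊆ ν.cells := fun c hc => hle hc
    have h3 := Finset.card_sdiff_add_card_eq_card hsub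
    change ν.cells.card = 2 * n at hn
    obtain ⟨T⟩ := ih (n - 1) (by change μ.cells.card = 2 * (n - 1); omega)
    have := T.exists_extension hle hd
    rwa [show n - 1 + 1 = n by omega] at this

/-- The head sequences of the domino tableaux of shape `lam` are those of the bi-tableaux whose
bi-shape has the same diagonals as one of them. -/
theorem isDominoHeadSeq_iff_isPairHeadSeq {n : ℕ} {lam μ ν : YoungDiagram} {h₀ : ℕ → ℤ}
    (h₁ : IsDominoHeadSeq n lam h₀) (hμ : ∀ k, headCount h₀ n (2 * k) = diagCard μ.cells k)
    (hν : ∀ k, headCount h₀ n (2 * k + 1) = diagCard ν.cells k) (h : ℕ → ℤ) :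
    IsDominoHeadSeq n lam h ↔ IsPairHeadSeq n μ ν h := by
  constructor
  · intro hh
    -- Both sequences fill `lam`, and its diagonal sizes determine the number of heads of each
    -- content.
    have heq : headCount h n = headCount h₀ n :=
      eq_of_add_succ_eq (finite_headCount_ne_zero h n) (finite_headCount_ne_zero h₀ n)
        fun k => by rw [hh.total, h₁.total]
    exact ⟨hh.zero, fun a ha => ((isDiagProfile_domino_iff _).1 (hh.profile a ha)).1,
      fun a ha => ((isDiagProfile_domino_iff _).1 (hh.profile a ha)).2,
      fun k => by rw [heq, hμ], fun k => by rw [heq, hν]⟩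
  · intro hh
    have heq : headCount h n = headCount h₀ n := by
      funext m
      obtain ⟨k, rfl | rfl⟩ : ∃ k, m = 2 * k ∨ m = 2 * k + 1 := ⟨m / 2, by omega⟩
      · rw [hh.total_fst, hμ]
      · rw [hh.total_snd, hν]
    exact ⟨hh.zero, fun a ha => (isDiagProfile_domino_iff _).2
      ⟨hh.profile_fst a ha, hh.profile_snd a ha⟩, fun k => by rw [heq, h₁.total]⟩

/-- The bijection between bi-tableaux and domino tableaux with the same head sequence. -/
theorem exists_equiv_heads_eq {n : ℕ} {lam μ ν : YoungDiagram}
    (h : ∀ h : ℕ → ℤ, IsDominoHeadSeq n lam h ↔ IsPairHeadSeq n μ ν h) :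
    ∃ ψ : StandardBiTableau n μ ν ≃ StandardDominoTableau n lam, ∀ B, (ψ B).heads = B.heads := by
  choose f hf using fun B : StandardBiTableau n μ ν =>
    ((h _).2 B.isPairHeadSeq_heads).exists_tableau
  refine ⟨Equiv.ofBijective f ⟨fun B B' hB => ?_, fun T => ?_⟩, hf⟩
  · exact StandardBiTableau.heads_injective (by rw [← hf, ← hf, hB])
  · obtain ⟨B, hB⟩ := ((h _).1 T.isDominoHeadSeq_heads).exists_tableau
    exact ⟨B, StandardDominoTableau.heads_injective (by rw [hf, hB])⟩

theorem mainTheorem10 (n : ℕ) (lam : YoungDiagram) (hlam : lam ∈ EmptyTwoCorePartitions n) :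
    (∃! q : YoungDiagram × YoungDiagram, IsTwoQuotient n lam q.1 q.2) ∧
      ∀ lamMinus lamPlus : YoungDiagram, IsTwoQuotient n lam lamMinus lamPlus →
        ∃ φ : StandardBiTableau n lamMinus lamPlus ≃ StandardDominoTableau n lam,
          ∀ B : StandardBiTableau n lamMinus lamPlus, B.DesR = (φ B).Des := by
  obtain ⟨T₀⟩ := hlam.2.nonempty_tableau n hlam.1
  have hT₀ := T₀.isDominoHeadSeq_heads
  -- The single tableau `T₀` already prescribes all diagonal sizes of any 2-quotient.
  have shape : ∀ μ ν, IsTwoQuotient n lam μ ν →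
      (∀ k, headCount T₀.heads n (2 * k) = diagCard μ.cells k) ∧
        ∀ k, headCount T₀.heads n (2 * k + 1) = diagCard ν.cells k := by
    intro μ ν hq
    obtain ⟨B, hB⟩ := hq T₀
    rw [← (B.isAssociated_iff_heads_eq T₀).1 hB]
    exact ⟨B.isPairHeadSeq_heads.total_fst, B.isPairHeadSeq_heads.total_snd⟩
  constructor
  · have hprofile := (isDiagProfile_domino_iff _).1 (hT₀.profile n le_rfl)
    have hfin := finite_headCount_ne_zero T₀.heads n
    obtain ⟨μ, hμ⟩ := hprofile.1.exists_youngDiagram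
      (hfin.preimage fun a _ b _ hab => by omega)
    obtain ⟨ν, hν⟩ := hprofile.2.exists_youngDiagram
      (hfin.preimage fun a _ b _ hab => by omega)
    refine ⟨(μ, ν), fun T => ?_, ?_⟩
    · obtain ⟨B, hB⟩ := ((isDominoHeadSeq_iff_isPairHeadSeq hT₀ (fun k => (hμ k).symm)
        (fun k => (hν k).symm) T.heads).1 T.isDominoHeadSeq_heads).exists_tableau
      exact ⟨B, (B.isAssociated_iff_heads_eq T).2 hB⟩
    · rintro ⟨μ', ν'⟩ hq
      obtain ⟨h1, h2⟩ := shape μ' ν' hq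
      exact Prod.ext (YoungDiagram.eq_of_diagCard_eq fun k => by rw [← h1, hμ])
        (YoungDiagram.eq_of_diagCard_eq fun k => by rw [← h2, hν])
  · intro μ ν hq
    obtain ⟨h1, h2⟩ := shape μ ν hq
    obtain ⟨ψ, hψ⟩ := exists_equiv_heads_eq (isDominoHeadSeq_iff_isPairHeadSeq hT₀ h1 h2)
    obtain ⟨σ, hσ⟩ := StandardBiTableau.exists_perm_DesR_eq n μ ν
    -- `ψ` preserves heads, while `σ` first exchanges `DesR` for the descents of the head sequence.
    refine ⟨σ.trans ψ, fun B => Set.ext fun s => ?_⟩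
    rw [hσ, StandardDominoTableau.mem_Des_iff, Equiv.trans_apply, hψ]
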